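/- Let $K$ be an algebraically closed field of characteristic $0$ (for example $K=\mathbb{C}$, or an algebraic closure of $\mathbb{C}(a_0,a_1,a_2,a_3)$ when the parameters are regarded as indeterminates). Let $A_0,A_1,A_2,A_3\in K$ and put $$a_0=2A_0-3,\qquad a_i=A_i^2-(A_0-1)^2\quad(i=1,2,3).$$ Let $Z(a)=p_0\partial^4+p_1\partial^3+p_2\partial^2+p_3\partial+p_4$, $\partial=d/dt$, where $$\begin{aligned} p_0&=2(t+1)^2(t-1)^3,\\ p_1&=-4(t+1)(t-1)^2\{(2+a_0)+(a_0-2)t\},\\ p_2&=2(t-1)\{(a_0^2-2a_1+6a_0+2+a_2+a_3)+(3a_0^2+4a_0-4+2a_1)t+(a_0^2-4a_0+2-a_2-a_3)t^2\},\\ p_3&=(-4a_0^2-8a_0+4a_0a_1+4a_1-(2a_0+4)(a_2+a_3))\\ &\quad+(-2a_0^3-6a_0^2-4a_0a_1-4a_1+4(a_2+a_3))t+2a_0(a_0+a_2+a_3)t^2,\\ p_4&=2a_2a_3t+(a_1-a_2-a_3)(a_0+2)^2-2a_2a_3. \end{aligned}$$ Assume that the parameters are generic in the following sense: for every $(\varepsilon_0,\varepsilon_1,\varepsilon_2,\varepsilon_3)\in\{-1,0,1\}^4$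 other than $(0,0,0,0)$, $$\sum_{i=0}^{3}\varepsilon_i\bigl(A_i+\tfrac12\bigr)\notin\mathbb{Z}.$$ (This holds in particular if $1,A_0,A_1,A_2,A_3$ are linearly independent over $\mathbb{Q}$.) Then $Z(a)$ is a differential operator of order $4$ which is Fuchsian (every point of $\mathbb{P}^1(K)=K\cup\{\infty\}$ is an ordinary or a regular singular point), its set of singular points is exactly $\{1,-1,\infty\}$, and it is irreducible: it is not a product $Z_1Z_2$ of two differential operators of order less than $4$ with coefficients in the field $K(t)$ of rational functions. -/

import Mathlib

namespace FuchsODE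

noncomputable section

/-! ### The derivation `d/dt` of the field `K(t)` -/

/-- The derivative `d/dt` of a rational function, by the quotient rule. -/
def dFun {K : Type*} [Field K] (f : RatFunc K) : RatFunc K :=
  algebraMap (Polynomial K) (RatFunc K)
      (Polynomial.derivative f.num * f.denom - f.num * Polynomial.derivative f.denom) /
    algebraMap (Polynomial K) (RatFunc K) f.denom ^ 2

theorem dFun_div {K : Type*} [Field K] (p q : Polynomial K) (hq : q ≠ 0) :
    dFun (algebraMap (Polynomial K) (RatFunc K) p / algebraMap (Polynomial K) (RatFunc K) q) =
      algebraMap (Polynomial K) (RatFunc K)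
          (Polynomial.derivative p * q - p * Polynomial.derivative q) /
        algebraMap (Polynomial K) (RatFunc K) q ^ 2 := by
  set f : RatFunc K :=
    algebraMap (Polynomial K) (RatFunc K) p / algebraMap (Polynomial K) (RatFunc K) q with hf
  have hd : f.denom ≠ 0 := RatFunc.denom_ne_zero f
  have hq' : algebraMap (Polynomial K) (RatFunc K) q ≠ 0 := RatFunc.algebraMap_ne_zero hq
  have hd' : algebraMap (Polynomial K) (RatFunc K) f.denom ≠ 0 := RatFunc.algebraMap_ne_zero hd
  have h1 : f.num * q = p * f.denom := by
    apply RatFunc.algebraMap_injective K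
    have h2 := RatFunc.num_div_denom f
    rw [map_mul, map_mul]
    rw [hf, div_eq_div_iff hd' hq'] at h2
    exact h2
  have h3 := congrArg Polynomial.derivative h1
  simp only [Polynomial.derivative_mul] at h3
  unfold dFun
  rw [div_eq_div_iff (pow_ne_zero 2 hd') (pow_ne_zero 2 hq')]
  simp only [← map_pow, ← map_mul]
  congr 1
  linear_combination (f.denom * q) * h3 -
    (Polynomial.derivative f.denom * q + f.denom * Polynomial.derivative q) * h1

/-- The derivation `d/dt` of `K(t)` over `K`. -/
def ddt (K : Type*) [Field K] : Derivation K (RatFunc K) (RatFunc K) :=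
  Derivation.mk'
    { toFun := dFun
      map_add' := by
        intro x y
        induction x using RatFunc.induction_on with
        | f p q hq =>
          induction y using RatFunc.induction_on with
          | f r s hs =>
            have hq' := RatFunc.algebraMap_ne_zero hq
            have hs' := RatFunc.algebraMap_ne_zero hs
            rw [div_add_div _ _ hq' hs', ← map_mul, ← map_mul, ← map_mul, ← map_add,
              dFun_div _ _ (mul_ne_zero hq hs), dFun_div _ _ hq, dFun_div _ _ hs]
            simp only [Polynomial.derivative_mul, map_mul, map_add, map_sub]
            field_simp
            ring
      map_smul' := by
        intro c x
        induction x using RatFunc.induction_on with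
        | f p q hq =>
          have hq' := RatFunc.algebraMap_ne_zero hq
          have e : ∀ r : Polynomial K, algebraMap (Polynomial K) (RatFunc K) (c • r) =
              c • algebraMap (Polynomial K) (RatFunc K) r := fun r =>
            algebraMap.coe_smul c r (RatFunc K)
          rw [RingHom.id_apply, ← smul_div_assoc, ← e, dFun_div _ _ hq,
            dFun_div _ _ hq, Polynomial.derivative_smul, smul_mul_assoc, smul_mul_assoc,
            ← smul_sub, e, smul_div_assoc] }
    (by
      intro x y
      induction x using RatFunc.induction_on with
      | f p q hq =>
        induction y using RatFunc.induction_on with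
        | f r s hs =>
          have hq' := RatFunc.algebraMap_ne_zero hq
          have hs' := RatFunc.algebraMap_ne_zero hs
          simp only [LinearMap.coe_mk, AddHom.coe_mk, smul_eq_mul]
          rw [div_mul_div_comm, ← map_mul, ← map_mul,
            dFun_div _ _ (mul_ne_zero hq hs), dFun_div _ _ hq, dFun_div _ _ hs]
          simp only [Polynomial.derivative_mul, map_mul, map_add, map_sub]
          field_simp
          ring)

/-! ### Differential operators with rational coefficients

The ring `K(t)[∂]` is taken as a ring of `K`-linear endomorphisms of `K(t)`; the product is the
composition. In characteristic zero an operator determines its coefficients. -/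

/-- The derivation `∂ = d/dt` as an operator on `K(t)`. -/
def del (K : Type*) [Field K] : Module.End K (RatFunc K) := (ddt K).toLinearMap

/-- The multiplication by a rational function, as an operator on `K(t)`. -/
def mulOp {K : Type*} [Field K] (f : RatFunc K) : Module.End K (RatFunc K) :=
  LinearMap.mulLeft K f

/-- `L = f₀ + f₁ ∂ + ⋯ + fₙ ∂ⁿ` with rational functions `fᵢ` and `fₙ ≠ 0`. -/
def HasOrder {K : Type*} [Field K] (L : Module.End K (RatFunc K)) (n : ℕ) : Prop :=
  ∃ f : ℕ → RatFunc K, f n ≠ 0 ∧ L = ∑ i ∈ Finset.range (n + 1), mulOp (f i) * del K ^ i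

/-- `L` is a differential operator of positive order, and it is not a product of two
differential operators of lower order. -/
def IsIrreducible {K : Type*} [Field K] (L : Module.End K (RatFunc K)) : Prop :=
  ∃ n : ℕ, 0 < n ∧ HasOrder L n ∧
    ∀ (L₁ L₂ : Module.End K (RatFunc K)) (n₁ n₂ : ℕ),
      HasOrder L₁ n₁ → HasOrder L₂ n₂ → n₁ < n → n₂ < n → L ≠ L₁ * L₂

/-! ### Singular points on the projective line -/

/-- The rational function `f` has no pole at the finite point `c`. -/
def IsRegularAt {K : Type*} [Field K] (f : RatFunc K) (c : K) : Prop :=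
  f.denom.eval c ≠ 0

/-- The finite point `c` is an ordinary point of `L`: after division by the leading coefficient,
`L` is `∂ⁿ + q_{n-1} ∂^{n-1} + ⋯ + q₀`, where no `qᵢ` has a pole at `c`. -/
def IsOrdinaryFin {K : Type*} [Field K] (L : Module.End K (RatFunc K)) (c : K) : Prop :=
  ∃ (n : ℕ) (p : RatFunc K) (q : ℕ → RatFunc K), p ≠ 0 ∧
    L = mulOp p * (del K ^ n + ∑ i ∈ Finset.range n, mulOp (q i) * del K ^ i) ∧
    ∀ i < n, IsRegularAt (q i) c

/-- The finite point `c` is an ordinary or a regular singular point of `L`: after division by the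
leading coefficient, `L` is `∂ⁿ + q_{n-1} ∂^{n-1} + ⋯ + q₀`, where the pole of `qᵢ` at `c` has
order at most `n - i`. -/
def IsFuchsianFin {K : Type*} [Field K] (L : Module.End K (RatFunc K)) (c : K) : Prop :=
  ∃ (n : ℕ) (p : RatFunc K) (q : ℕ → RatFunc K), p ≠ 0 ∧
    L = mulOp p * (del K ^ n + ∑ i ∈ Finset.range n, mulOp (q i) * del K ^ i) ∧
    ∀ i < n, IsRegularAt ((RatFunc.X - RatFunc.C c) ^ (n - i) * q i) c

theorem aeval_inv_X_ne_zero {K : Type*} [Field K] :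
    nonZeroDivisors (Polynomial K) ≤
      (nonZeroDivisors (RatFunc K)).comap
        (Polynomial.aeval (R := K) ((RatFunc.X : RatFunc K)⁻¹)) := by
  intro p hp
  have h : Transcendental K ((RatFunc.X : RatFunc K)⁻¹) := fun h =>
    RatFunc.transcendental_X (K := K) (by simpa using h.inv)
  rw [Submonoid.mem_comap, mem_nonZeroDivisors_iff_ne_zero]
  intro h0
  exact nonZeroDivisors.ne_zero hp ((transcendental_iff.mp h) p h0)

/-- The substitution `t ↦ 1/t` in rational functions. -/
def inversion (K : Type*) [Field K] : RatFunc K →ₐ[K] RatFunc K :=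
  RatFunc.liftAlgHom (Polynomial.aeval ((RatFunc.X : RatFunc K)⁻¹)) aeval_inv_X_ne_zero

/-- The operator `L` written in the coordinate `s = 1/t` (and `s` is again called `t`). -/
def atInfinity {K : Type*} [Field K] (L : Module.End K (RatFunc K)) :
    Module.End K (RatFunc K) :=
  (inversion K).toLinearMap * L * (inversion K).toLinearMap

/-- `x` is an ordinary point of `L`. -/
def IsOrdinaryAt {K : Type*} [Field K] (L : Module.End K (RatFunc K)) (x : OnePoint K) : Prop :=
  x.elim (IsOrdinaryFin (atInfinity L) 0) (fun c => IsOrdinaryFin L c)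

/-- The singular points of `L` on the projective line `K ∪ {∞}`. -/
def singularPoints {K : Type*} [Field K] (L : Module.End K (RatFunc K)) : Set (OnePoint K) :=
  {x | ¬ IsOrdinaryAt L x}

/-- All points of the projective line are ordinary or regular singular points of `L`. -/
def IsFuchsian {K : Type*} [Field K] (L : Module.End K (RatFunc K)) : Prop :=
  (∀ c : K, IsFuchsianFin L c) ∧ IsFuchsianFin (atInfinity L) 0

/-! ### The operator `Z(a)` -/

/-- The coefficients `p₀, …, p₄` of `Z(a)`, for the parameters `a₀, a₁, a₂, a₃` and the
variable `t`. -/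
def zCoeff {R : Type*} [CommRing R] (a₀ a₁ a₂ a₃ t : R) : Fin 5 → R :=
  ![2 * (t + 1) ^ 2 * (t - 1) ^ 3,
    -4 * (t + 1) * (t - 1) ^ 2 * ((2 + a₀) + (a₀ - 2) * t),
    2 * (t - 1) * ((a₀ ^ 2 - 2 * a₁ + 6 * a₀ + 2 + a₂ + a₃)
      + (3 * a₀ ^ 2 + 4 * a₀ - 4 + 2 * a₁) * t
      + (a₀ ^ 2 - 4 * a₀ + 2 - a₂ - a₃) * t ^ 2),
    (-4 * a₀ ^ 2 - 8 * a₀ + 4 * a₀ * a₁ + 4 * a₁ - (2 * a₀ + 4) * (a₂ + a₃))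
      + (-2 * a₀ ^ 3 - 6 * a₀ ^ 2 - 4 * a₀ * a₁ - 4 * a₁ + 4 * (a₂ + a₃)) * t
      + 2 * a₀ * (a₀ + a₂ + a₃) * t ^ 2,
    2 * a₂ * a₃ * t + (a₁ - a₂ - a₃) * (a₀ + 2) ^ 2 - 2 * a₂ * a₃]

/-- The operator `Z(a) = p₀ ∂⁴ + p₁ ∂³ + p₂ ∂² + p₃ ∂ + p₄`. -/
def Z {K : Type*} [Field K] (a : Fin 4 → K) : Module.End K (RatFunc K) :=
  ∑ i : Fin 5,
    mulOp (zCoeff (RatFunc.C (a 0)) (RatFunc.C (a 1)) (RatFunc.C (a 2)) (RatFunc.C (a 3))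
      RatFunc.X i) * del K ^ (4 - (i : ℕ))

end

end FuchsODE

/-!
The proof is local analysis at all places of the projective line, followed by a count of exponents.

At a place with uniformizer `w`, an operator `L` maps `w ^ s (a + O(w))` to
`w ^ (s + e) (P(s) a + O(w))` for a fixed integer `e` and a fixed polynomial `P`, the indicial
polynomial (`Place.IsIndicial`). Defined by this action on functions, it is unique, and it is
multiplicative up to a shift: the indicial polynomial of `L₁ L₂` is `P₁(T + e₂) P₂(T)`. Its degree
is at most the order of `L`, and equality means that the place is ordinary or regular singular
(`Place.IsIndicial.coeff_of_natDegree_eq`). Hence a right factor of a Fuchsian operator is Fuchsian,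
and its exponents at each place are among those of the operator
(`Place.IsIndicial.exists_exponents`).

The exponents of `Z(a)` are `0, 2A₀, A₀ ± 1/2` at `1`, then `0, 1, 1/2 ± A₁` at `-1`, then
`1 - A₀ ± A₂, 1 - A₀ ± A₃` at infinity, and `0, 1, 2, 3` elsewhere. There are four of them at each
place, so `Z(a)` is Fuchsian; by genericity there is a non-integral one at `1`, `-1` and infinity,
so these points are singular.

For a right factor `∂ⁿ + b ∂ⁿ⁻¹ + ⋯` with `0 < n < 4`, the sum of the exponents at each place
is determined by the residue of `b` (`Place.IsIndicial.sum_roots`), and the residue theorem for `b`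
(`exists_sum_residue`) becomes the Fuchs relation for the right factor. Modulo the integers, the
relation is a combination of the `Aᵢ + 1/2` with coefficients in `{-1, 0, 1}`. By genericity all
coefficients vanish, which is impossible for `n = 1` and `n = 3`. For `n = 2` the exponents at `1`,
`-1` and infinity then add up to `3`, while the Fuchs relation bounds this sum by `1`, since the
apparent singularities of the factor contribute nonnegative integers (`fuchs_relation_ne`).
-/

namespace FuchsODE

open Polynomial

/-! ### Derivation and inversion on explicit functions -/

section Derivation

variable {K : Type*} [Field K]

theorem ddt_algebraMap (p : K[X]) :
    ddt K (algebraMap K[X] (RatFunc K) p) = algebraMap K[X] (RatFunc K) (derivative p) := by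
  have h := dFun_div p 1 one_ne_zero
  simp only [map_one, div_one, one_pow, derivative_one, mul_zero, mul_one, sub_zero] at h
  exact h

theorem ddt_X : ddt K RatFunc.X = 1 := by
  rw [← RatFunc.algebraMap_X, ddt_algebraMap, derivative_X, map_one]

theorem ddt_C (a : K) : ddt K (RatFunc.C a) = 0 := by
  rw [← RatFunc.algebraMap_C, ddt_algebraMap, derivative_C, map_zero]

theorem inversion_algebraMap (p : K[X]) :
    inversion K (algebraMap K[X] (RatFunc K) p) = aeval ((RatFunc.X : RatFunc K)⁻¹) p := by
  have h := RatFunc.liftAlgHom_apply_div (aeval ((RatFunc.X : RatFunc K)⁻¹))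
    aeval_inv_X_ne_zero p 1
  simpa [inversion] using h

theorem inversion_X : inversion K RatFunc.X = (RatFunc.X : RatFunc K)⁻¹ := by
  rw [← RatFunc.algebraMap_X, inversion_algebraMap, aeval_X, RatFunc.algebraMap_X]

theorem inversion_C (a : K) : inversion K (RatFunc.C a) = RatFunc.C a := by
  rw [← RatFunc.algebraMap_eq_C, AlgHom.commutes]

theorem inversion_inversion (f : RatFunc K) : inversion K (inversion K f) = f := by
  have h (p : K[X]) : inversion K (inversion K (algebraMap K[X] (RatFunc K) p)) =
      algebraMap K[X] (RatFunc K) p := by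
    rw [inversion_algebraMap, ← aeval_algHom_apply, map_inv₀, inversion_X, inv_inv,
      ← RatFunc.algebraMap_X, aeval_algebraMap_apply, aeval_X_left_apply]
  induction f using RatFunc.induction_on with
  | f p q hq => rw [map_div₀, map_div₀, h, h]

/-- The chain rule for the substitution `t ↦ 1/t`. -/
theorem ddt_inversion (f : RatFunc K) :
    ddt K (inversion K f) = -(RatFunc.X ^ 2)⁻¹ * inversion K (ddt K f) := by
  have h (p : K[X]) : ddt K (inversion K (algebraMap K[X] (RatFunc K) p)) =
      -(RatFunc.X ^ 2)⁻¹ * inversion K (ddt K (algebraMap K[X] (RatFunc K) p)) := by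
    rw [ddt_algebraMap, inversion_algebraMap, inversion_algebraMap, Derivation.map_aeval,
      Derivation.leibniz_inv, ddt_X]
    simp only [smul_eq_mul, mul_one, inv_pow]
    ring
  induction f using RatFunc.induction_on with
  | f p q hq =>
    rw [map_div₀, Derivation.leibniz_div, Derivation.leibniz_div, h, h]
    simp only [smul_eq_mul, map_mul, map_sub, map_pow, map_inv₀]
    ring

theorem ratFunc_X_sub_C_ne_zero (c : K) : (RatFunc.X - RatFunc.C c : RatFunc K) ≠ 0 := by
  rw [← RatFunc.algebraMap_X, ← RatFunc.algebraMap_C, ← map_sub]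
  exact RatFunc.algebraMap_ne_zero (X_sub_C_ne_zero c)

end Derivation

/-! ### Places of the projective line -/

section FiniteValue

variable {K : Type*} [Field K]

/-- The rational function `f` has no pole at the finite point `c`, and its value there is `a`. -/
def HasValueAt (c : K) (f : RatFunc K) (a : K) : Prop :=
  ∃ p q : K[X], q.eval c ≠ 0 ∧
    f * algebraMap K[X] (RatFunc K) q = algebraMap K[X] (RatFunc K) p ∧ p.eval c = a * q.eval c

theorem hasValueAt_algebraMap (c : K) (p : K[X]) :
    HasValueAt c (algebraMap K[X] (RatFunc K) p) (p.eval c) :=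
  ⟨p, 1, by simp, by simp, by simp⟩

theorem HasValueAt.add {c : K} {f g : RatFunc K} {a b : K} (hf : HasValueAt c f a)
    (hg : HasValueAt c g b) : HasValueAt c (f + g) (a + b) := by
  obtain ⟨p, q, hq, h, e⟩ := hf
  obtain ⟨r, s, hs, h', e'⟩ := hg
  refine ⟨p * s + r * q, q * s, ?_, ?_, ?_⟩
  · rw [eval_mul]; exact mul_ne_zero hq hs
  · simp only [map_add, map_mul, ← h, ← h']; ring
  · simp only [eval_add, eval_mul, e, e']; ring

theorem HasValueAt.mul {c : K} {f g : RatFunc K} {a b : K} (hf : HasValueAt c f a)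
    (hg : HasValueAt c g b) : HasValueAt c (f * g) (a * b) := by
  obtain ⟨p, q, hq, h, e⟩ := hf
  obtain ⟨r, s, hs, h', e'⟩ := hg
  refine ⟨p * r, q * s, ?_, ?_, ?_⟩
  · rw [eval_mul]; exact mul_ne_zero hq hs
  · simp only [map_mul, ← h, ← h']; ring
  · simp only [eval_mul, e, e']; ring

theorem HasValueAt.unique {c : K} {f : RatFunc K} {a b : K} (hf : HasValueAt c f a)
    (hg : HasValueAt c f b) : a = b := by
  obtain ⟨p, q, hq, h, e⟩ := hf
  obtain ⟨r, s, hs, h', e'⟩ := hg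
  have h1 : p * s = r * q := by
    apply RatFunc.algebraMap_injective K
    simp only [map_mul, ← h, ← h']; ring
  have h2 := congrArg (eval c) h1
  simp only [eval_mul, e, e'] at h2
  exact mul_right_cancel₀ (mul_ne_zero hq hs) (by linear_combination h2)

theorem HasValueAt.inv {c : K} {f : RatFunc K} {a : K} (hf : HasValueAt c f a) (ha : a ≠ 0) :
    HasValueAt c f⁻¹ a⁻¹ := by
  obtain ⟨p, q, hq, h, e⟩ := hf
  have hq' : algebraMap K[X] (RatFunc K) q ≠ 0 :=
    RatFunc.algebraMap_ne_zero (fun h => hq (by simp [h]))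
  have hp : p.eval c ≠ 0 := by rw [e]; exact mul_ne_zero ha hq
  have hp' : algebraMap K[X] (RatFunc K) p ≠ 0 :=
    RatFunc.algebraMap_ne_zero (fun h => hp (by simp [h]))
  refine ⟨q, p, hp, ?_, ?_⟩
  · rw [← h] at hp' ⊢
    have := left_ne_zero_of_mul hp'
    field_simp
  · rw [e]; field_simp

theorem HasValueAt.ddt {c : K} {f : RatFunc K} {a : K} (hf : HasValueAt c f a) :
    ∃ b, HasValueAt c (ddt K f) b := by
  obtain ⟨p, q, hq, h, e⟩ := hf
  have h1 := congrArg (FuchsODE.ddt K) h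
  rw [Derivation.leibniz, ddt_algebraMap, ddt_algebraMap] at h1
  simp only [smul_eq_mul] at h1
  refine ⟨(derivative p * q - p * derivative q).eval c / (q * q).eval c,
    derivative p * q - p * derivative q, q * q, ?_, ?_, ?_⟩
  · rw [eval_mul]; exact mul_ne_zero hq hq
  · simp only [map_sub, map_mul, ← h1, ← h]; ring
  · rw [div_mul_cancel₀]
    rw [eval_mul]; exact mul_ne_zero hq hq

theorem HasValueAt.of_mul {c : K} {f : RatFunc K}
    (h : HasValueAt c ((RatFunc.X - RatFunc.C c) * f) 0) : ∃ a, HasValueAt c f a := by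
  obtain ⟨p, q, hq, h, e⟩ := h
  rw [zero_mul] at e
  obtain ⟨r, rfl⟩ := dvd_iff_isRoot.mpr e
  refine ⟨r.eval c / q.eval c, r, q, hq, ?_, (div_mul_cancel₀ _ hq).symm⟩
  apply mul_left_cancel₀ (ratFunc_X_sub_C_ne_zero c)
  simp only [map_mul, map_sub, RatFunc.algebraMap_X, RatFunc.algebraMap_C] at h
  rw [← h]; ring

theorem HasValueAt.exists_order (c : K) {f : RatFunc K} (hf : f ≠ 0) :
    ∃ (e : ℤ) (a : K), a ≠ 0 ∧ HasValueAt c ((RatFunc.X - RatFunc.C c) ^ (-e) * f) a := by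
  have key (p : K[X]) (hp : p ≠ 0) : ∃ (n : ℕ) (r : K[X]), r.eval c ≠ 0 ∧
      algebraMap K[X] (RatFunc K) p =
        (RatFunc.X - RatFunc.C c) ^ n * algebraMap K[X] (RatFunc K) r := by
    obtain ⟨r, h1, h2⟩ := exists_eq_pow_rootMultiplicity_mul_and_not_dvd p hp c
    refine ⟨p.rootMultiplicity c, r, fun h => h2 (dvd_iff_isRoot.mpr h), ?_⟩
    conv_lhs => rw [h1]
    simp
  induction f using RatFunc.induction_on with
  | f p q hq =>
    have hp : p ≠ 0 := by rintro rfl; simp at hf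
    obtain ⟨m, r, hr, h1⟩ := key p hp
    obtain ⟨n, s, hs, h2⟩ := key q hq
    have hs' : algebraMap K[X] (RatFunc K) s ≠ 0 :=
      RatFunc.algebraMap_ne_zero (fun h => hs (by simp [h]))
    refine ⟨m - n, r.eval c / s.eval c, div_ne_zero hr hs, r, s, hs, ?_,
      (div_mul_cancel₀ _ hs).symm⟩
    have hX := ratFunc_X_sub_C_ne_zero c
    rw [h1, h2, neg_sub, zpow_sub₀ hX, zpow_natCast, zpow_natCast]
    field_simp

theorem isRegularAt_iff {c : K} {f : RatFunc K} : IsRegularAt f c ↔ ∃ a, HasValueAt c f a := by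
  constructor
  · intro h
    refine ⟨f.num.eval c / f.denom.eval c, f.num, f.denom, h, ?_, (div_mul_cancel₀ _ h).symm⟩
    exact (div_eq_iff (RatFunc.algebraMap_ne_zero f.denom_ne_zero)).mp
      (RatFunc.num_div_denom f) |>.symm
  · rintro ⟨a, p, q, hq, h, -⟩ h0
    have hq0 : q ≠ 0 := fun h => hq (by simp [h])
    have hd : f.denom ∣ q := (RatFunc.denom_dvd hq0).mpr
      ⟨p, by rw [eq_div_iff (RatFunc.algebraMap_ne_zero hq0), h]⟩
    exact hq (eval_eq_zero_of_dvd_of_eval_eq_zero hd h0)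

theorem hasValueAt_unif (c : K) : HasValueAt c (RatFunc.X - RatFunc.C c) 0 := by
  have h := hasValueAt_algebraMap c (X - C c)
  rwa [map_sub, RatFunc.algebraMap_X, RatFunc.algebraMap_C, eval_sub, eval_X, eval_C,
    sub_self] at h

theorem hasValueAt_C (c a : K) : HasValueAt c (RatFunc.C a) a := by
  simpa using hasValueAt_algebraMap c (C a)

end FiniteValue

/-- A place of `K(t)` over `K` with residue field `K`: the relation "`f` is regular with value
`a`", and a uniformizer `w` whose derivative is `± w ^ (1 ∓ 1)`. The sign is `1` for
`w = t - c` and `-1` for `w = 1/t`. -/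
structure Place (K : Type*) [Field K] where
  /-- `f` is regular at the place, with value `a` -/
  HasValue : RatFunc K → K → Prop
  /-- the uniformizer -/
  w : RatFunc K
  /-- the sign in `d w / d t = ± w ^ (1 ∓ 1)` -/
  sgn : ℤˣ
  w_ne_zero : w ≠ 0
  add : ∀ {f g a b}, HasValue f a → HasValue g b → HasValue (f + g) (a + b)
  mul : ∀ {f g a b}, HasValue f a → HasValue g b → HasValue (f * g) (a * b)
  const : ∀ a, HasValue (RatFunc.C a) a
  unique : ∀ {f a b}, HasValue f a → HasValue f b → a = b
  inv : ∀ {f a}, HasValue f a → a ≠ 0 → HasValue f⁻¹ a⁻¹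
  unif : HasValue w 0
  exists_order : ∀ {f}, f ≠ 0 → ∃ (e : ℤ) (a : K), a ≠ 0 ∧ HasValue (w ^ (-e) * f) a
  ddt_w : ddt K w = (sgn : ℤ) * w ^ (1 - (sgn : ℤ))
  ddt_val : ∀ {f a}, HasValue f a → HasValue (w ^ (sgn : ℤ) * ddt K f) 0

section Places

variable {K : Type*} [Field K]

/-- The finite place `t = c`, with the uniformizer `t - c`. -/
noncomputable def finitePlace (c : K) : Place K where
  HasValue := HasValueAt c
  w := RatFunc.X - RatFunc.C c
  sgn := 1
  w_ne_zero := ratFunc_X_sub_C_ne_zero c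
  add := HasValueAt.add
  mul := HasValueAt.mul
  const := hasValueAt_C c
  unique := HasValueAt.unique
  inv := HasValueAt.inv
  unif := hasValueAt_unif c
  exists_order := HasValueAt.exists_order c
  ddt_w := by simp [ddt_X, ddt_C]
  ddt_val := by
    intro f a h
    obtain ⟨b, hb⟩ := h.ddt
    simpa using (hasValueAt_unif c).mul hb

theorem inversion_ne_zero {f : RatFunc K} (hf : f ≠ 0) : inversion K f ≠ 0 := fun h =>
  hf (by rw [← inversion_inversion f, h, map_zero])

/-- The place at infinity, with the uniformizer `1/t`; values are read off after `t ↦ 1/t`. -/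
noncomputable def infinitePlace (K : Type*) [Field K] : Place K where
  HasValue f a := HasValueAt 0 (inversion K f) a
  w := RatFunc.X⁻¹
  sgn := -1
  w_ne_zero := inv_ne_zero RatFunc.X_ne_zero
  add h h' := by rw [map_add]; exact h.add h'
  mul h h' := by rw [map_mul]; exact h.mul h'
  const a := by rw [inversion_C]; exact hasValueAt_C 0 a
  unique := HasValueAt.unique
  inv h ha := by rw [map_inv₀]; exact h.inv ha
  unif := by simpa [inversion_X] using hasValueAt_unif (0 : K)
  exists_order := by
    intro f hf
    obtain ⟨e, a, ha, h⟩ := HasValueAt.exists_order 0 (inversion_ne_zero hf)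
    exact ⟨e, a, ha, by simpa [inversion_X, map_zpow₀] using h⟩
  ddt_w := by
    rw [Derivation.leibniz_inv, ddt_X]
    norm_num [zpow_ofNat]
  ddt_val := by
    intro f a h
    obtain ⟨b, hb⟩ := h.ddt
    have h1 : inversion K (RatFunc.X⁻¹ ^ (((-1 : ℤˣ) : ℤ)) * ddt K f) =
        RatFunc.C (-1) * (RatFunc.X - RatFunc.C 0) * ddt K (inversion K f) := by
      have hX : (RatFunc.X : RatFunc K) ≠ 0 := RatFunc.X_ne_zero
      rw [ddt_inversion]
      simp [inversion_X]
      field_simp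
    rw [h1]
    simpa using ((hasValueAt_C 0 (-1)).mul (hasValueAt_unif (0 : K))).mul hb

end Places

/-! ### Indicial polynomials -/

section Indicial

variable {K : Type*} [Field K]

namespace Place

variable {v : Place K}

theorem zero (v : Place K) : v.HasValue 0 0 := by simpa using v.const 0

theorem one (v : Place K) : v.HasValue 1 1 := by simpa using v.const 1

theorem sum (v : Place K) {ι : Type*} (s : Finset ι) {f : ι → RatFunc K} {a : ι → K}
    (h : ∀ i ∈ s, v.HasValue (f i) (a i)) : v.HasValue (∑ i ∈ s, f i) (∑ i ∈ s, a i) := by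
  classical
  induction s using Finset.induction_on with
  | empty => simpa using v.zero
  | insert i s hi ih =>
    rw [Finset.sum_insert hi, Finset.sum_insert hi]
    exact v.add (h i (by simp)) (ih fun j hj => h j (by simp [hj]))

theorem pow (v : Place K) {f : RatFunc K} {a : K} (h : v.HasValue f a) (n : ℕ) :
    v.HasValue (f ^ n) (a ^ n) := by
  induction n with
  | zero => simpa using v.one
  | succ n ih => rw [pow_succ, pow_succ]; exact v.mul ih h

/-- Multiplication by a positive power of the uniformizer kills the value. -/
theorem zpow_mul (v : Place K) {f : RatFunc K} {a : K} {e e' : ℤ} (he : e' < e)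
    (h : v.HasValue (v.w ^ (-e) * f) a) : v.HasValue (v.w ^ (-e') * f) 0 := by
  have h1 := v.mul (v.pow v.unif (e - e').toNat) h
  have h2 : v.w ^ (e - e').toNat = v.w ^ (e - e') := by
    rw [← zpow_natCast, Int.toNat_of_nonneg (by lia)]
  rw [zero_pow (by lia), zero_mul, h2, ← mul_assoc, ← zpow_add₀ v.w_ne_zero] at h1
  convert h1 using 3
  ring

/-- The operator `L` multiplies the function `w ^ s (a + O(w))` into
`w ^ (s + e) (P(s) a + O(w))`. If `P ≠ 0`, then `P` is the indicial polynomial of `L` at the place,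
and its roots are the exponents. -/
def IsIndicial (v : Place K) (L : Module.End K (RatFunc K)) (e : ℤ) (P : K[X]) : Prop :=
  ∀ (s : ℤ) (f : RatFunc K) (a : K), v.HasValue (v.w ^ (-s) * f) a →
    v.HasValue (v.w ^ (-(s + e)) * L f) (P.eval (s : K) * a)

/-- The indicial polynomial of a product is a product of indicial polynomials up to a shift. -/
theorem IsIndicial.mul {L₁ L₂ : Module.End K (RatFunc K)} {e₁ e₂ : ℤ} {P₁ P₂ : K[X]}
    (h₁ : v.IsIndicial L₁ e₁ P₁) (h₂ : v.IsIndicial L₂ e₂ P₂) :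
    v.IsIndicial (L₁ * L₂) (e₁ + e₂) (P₁.comp (X + C (e₂ : K)) * P₂) := by
  intro s f a h
  have := h₁ _ _ _ (h₂ s f a h)
  rw [Module.End.mul_apply]
  convert this using 1
  · congr 2; ring
  · simp; ring

theorem IsIndicial.sum {ι : Type*} {e : ℤ} (s : Finset ι)
    {L : ι → Module.End K (RatFunc K)} {P : ι → K[X]}
    (h : ∀ i ∈ s, v.IsIndicial (L i) e (P i)) :
    v.IsIndicial (∑ i ∈ s, L i) e (∑ i ∈ s, P i) := by
  intro n f a hf
  rw [LinearMap.sum_apply, Finset.mul_sum, eval_finsetSum, Finset.sum_mul]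
  exact v.sum s fun i hi => h i hi n f a hf

theorem IsIndicial.mulOp {f : RatFunc K} {e : ℤ} {a : K} (h : v.HasValue (v.w ^ (-e) * f) a) :
    v.IsIndicial (mulOp f) e (C a) := by
  intro s g b hg
  have h1 := v.mul h hg
  rw [eval_C]
  convert h1 using 1
  rw [FuchsODE.mulOp, LinearMap.mulLeft_apply, neg_add, zpow_add₀ v.w_ne_zero]
  ring

theorem IsIndicial.del : v.IsIndicial (del K) (-(v.sgn : ℤ)) (C ((v.sgn : ℤ) : K) * X) := by
  intro s f a h
  have hw := v.w_ne_zero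
  set g := v.w ^ (-s) * f with hg
  have hf : f = v.w ^ s * g := by rw [hg, ← mul_assoc, ← zpow_add₀ hw]; simp
  have h1 : v.w ^ (-(s + -(v.sgn : ℤ))) * FuchsODE.del K f =
      RatFunc.C (((v.sgn : ℤ) : K) * s) * g + v.w ^ (v.sgn : ℤ) * ddt K g := by
    have h2 : FuchsODE.del K f = ddt K f := rfl
    rw [h2, hf, Derivation.leibniz, Derivation.leibniz_zpow, v.ddt_w]
    simp only [smul_eq_mul, zsmul_eq_mul, map_mul, map_intCast]
    rw [show -(s + -(v.sgn : ℤ)) = -s + (v.sgn : ℤ) by ring, zpow_add₀ hw, zpow_neg,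
      zpow_sub₀ hw, zpow_sub₀ hw, zpow_one]
    field_simp
    ring
  rw [h1]
  have h3 := v.add (v.mul (v.const (((v.sgn : ℤ) : K) * s)) h) (v.ddt_val h)
  simpa using h3

theorem sgn_mul_sgn (v : Place K) : ((v.sgn : ℤ) : K) * ((v.sgn : ℤ) : K) = 1 := by
  rw [← Int.cast_mul, ← Units.val_mul, Int.units_mul_self]; simp

theorem sgn_ne_zero (v : Place K) : ((v.sgn : ℤ) : K) ≠ 0 :=
  left_ne_zero_of_mul_eq_one v.sgn_mul_sgn

theorem IsIndicial.del_pow (n : ℕ) :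
    v.IsIndicial (FuchsODE.del K ^ n) (-((v.sgn : ℤ) * n))
      ((descPochhammer K n).comp (C ((v.sgn : ℤ) : K) * X)) := by
  induction n with
  | zero => intro s f a h; simpa using h
  | succ n ih =>
    have h := IsIndicial.del.mul ih
    rw [← pow_succ'] at h
    convert h using 1
    · push_cast; ring
    · rw [descPochhammer_succ_right]
      have h1 : (C ((v.sgn : ℤ) : K) : K[X]) * C ((v.sgn : ℤ) : K) = 1 := by
        rw [← C_mul, v.sgn_mul_sgn, C_1]
      simp only [mul_comp, sub_comp, X_comp, natCast_comp, C_comp, Int.cast_neg, Int.cast_mul,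
        Int.cast_natCast, C_neg, C_mul, map_natCast]
      linear_combination ((descPochhammer K n).comp (C ((v.sgn : ℤ) : K) * X) * n) * h1

/-- Indicial polynomial of an operator from the leading terms of its coefficients. -/
theorem IsIndicial.of_coeff {n : ℕ} {f : ℕ → RatFunc K} {e : ℤ} {c : ℕ → K}
    (h : ∀ i < n + 1, v.HasValue (v.w ^ (-(e + (v.sgn : ℤ) * i)) * f i) (c i)) :
    v.IsIndicial (∑ i ∈ Finset.range (n + 1), FuchsODE.mulOp (f i) * FuchsODE.del K ^ i) e
      ((∑ i ∈ Finset.range (n + 1), C (c i) * descPochhammer K i).comp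
        (C ((v.sgn : ℤ) : K) * X)) := by
  rw [← coe_compRingHom_apply, map_sum]
  refine IsIndicial.sum _ fun i hi => ?_
  convert (IsIndicial.mulOp (h i (Finset.mem_range.mp hi))).mul (IsIndicial.del_pow i) using 1
  · ring
  · simp

theorem IsIndicial.unique_of_eq [CharZero K] {L : Module.End K (RatFunc K)} {e : ℤ} {P Q : K[X]}
    (h : v.IsIndicial L e P) (h' : v.IsIndicial L e Q) : P = Q := by
  refine Polynomial.eq_of_infinite_eval_eq P Q
    (Set.infinite_of_injective_forall_mem (f := fun n : ℤ => (n : K)) Int.cast_injective ?_)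
  intro s
  have h1 : v.HasValue (v.w ^ (-s) * v.w ^ s) 1 := by
    rw [← zpow_add₀ v.w_ne_zero]; simpa using v.one
  simpa using v.unique (h s _ 1 h1) (h' s _ 1 h1)

theorem IsIndicial.of_lt {L : Module.End K (RatFunc K)} {e e' : ℤ} {P : K[X]}
    (h : v.IsIndicial L e P) (he : e' < e) : v.IsIndicial L e' 0 := by
  intro s f a hf
  have := v.zpow_mul (e' := s + e') (by lia) (h s f a hf)
  simpa using this

theorem IsIndicial.unique [CharZero K] {L : Module.End K (RatFunc K)} {e e' : ℤ} {P Q : K[X]}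
    (h : v.IsIndicial L e P) (h' : v.IsIndicial L e' Q) (hP : P ≠ 0) (hQ : Q ≠ 0) : P = Q := by
  rcases lt_trichotomy e e' with he | rfl | he
  · exact absurd (h.unique_of_eq (h'.of_lt he)) hP
  · exact h.unique_of_eq h'
  · exact absurd (h'.unique_of_eq (h.of_lt he)) hQ

end Place

theorem natDegree_sum_descPochhammer_le (n : ℕ) (c : ℕ → K) :
    (∑ i ∈ Finset.range (n + 1), C (c i) * descPochhammer K i).natDegree ≤ n := by
  refine natDegree_sum_le_of_forall_le _ _ fun i hi => ?_
  refine (natDegree_C_mul_le _ _).trans ?_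
  rw [descPochhammer_natDegree]
  exact Nat.lt_succ_iff.mp (Finset.mem_range.mp hi)

theorem coeff_sum_descPochhammer (n : ℕ) (c : ℕ → K) :
    (∑ i ∈ Finset.range (n + 1), C (c i) * descPochhammer K i).coeff n = c n := by
  have h1 : (descPochhammer K n).coeff n = 1 := by
    have := (monic_descPochhammer K n).coeff_natDegree
    rwa [descPochhammer_natDegree] at this
  rw [Finset.sum_range_succ, coeff_add, coeff_C_mul, h1, mul_one, add_eq_right]
  cases n with
  | zero => simp
  | succ n =>
    exact coeff_eq_zero_of_natDegree_lt
      (Nat.lt_succ_of_le (natDegree_sum_descPochhammer_le n c))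

theorem coeff_descPochhammer_succ [CharZero K] (n : ℕ) :
    (descPochhammer K (n + 1)).coeff n = -((n : K) * (n + 1) / 2) := by
  induction n with
  | zero => simp
  | succ n ih =>
    have h1 : (descPochhammer K (n + 1)).coeff (n + 1) = 1 := by
      have := (monic_descPochhammer K (n + 1)).coeff_natDegree
      rwa [descPochhammer_natDegree] at this
    rw [descPochhammer_succ_right, mul_sub, coeff_sub, coeff_mul_X, ih, ← C_eq_natCast,
      coeff_mul_C, h1]
    push_cast
    ring

theorem coeff_pred_sum_descPochhammer [CharZero K] (n : ℕ) (c : ℕ → K) :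
    (∑ i ∈ Finset.range (n + 1 + 1), C (c i) * descPochhammer K i).coeff n =
      c n - c (n + 1) * (n * (n + 1) / 2) := by
  rw [Finset.sum_range_succ, coeff_add, coeff_sum_descPochhammer, coeff_C_mul,
    coeff_descPochhammer_succ]
  ring

theorem sum_descPochhammer_ne_zero {n : ℕ} {c : ℕ → K} (h : ∃ i < n + 1, c i ≠ 0) :
    ∑ i ∈ Finset.range (n + 1), C (c i) * descPochhammer K i ≠ 0 := by
  induction n with
  | zero =>
    obtain ⟨i, hi, hc⟩ := h
    obtain rfl : i = 0 := by lia
    simpa using hc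
  | succ n ih =>
    by_cases hn : c (n + 1) = 0
    · rw [Finset.sum_range_succ, hn]
      obtain ⟨i, hi, hc⟩ := h
      simpa using ih ⟨i, lt_of_le_of_ne (Nat.lt_succ_iff.mp hi) (fun h => hc (h ▸ hn)), hc⟩
    · intro h0
      apply hn
      rw [← coeff_sum_descPochhammer (n + 1) c, h0, coeff_zero]

/-- At every place an operator can be normalized so that the coefficients of the powers of
`w d/dw` are regular and not all of them vanish. -/
theorem Place.exists_normalForm (v : Place K) (n : ℕ) (f : ℕ → RatFunc K)
    (hf : ∃ i < n + 1, f i ≠ 0) :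
    ∃ (e : ℤ) (c : ℕ → K), (∃ i < n + 1, c i ≠ 0) ∧
      ∀ i < n + 1, v.HasValue (v.w ^ (-(e + (v.sgn : ℤ) * i)) * f i) (c i) := by
  classical
  choose! o l hl ho using fun (i : ℕ) (h : f i ≠ 0) => v.exists_order h
  obtain ⟨j, hj, hmin⟩ := Finset.exists_min_image
    ((Finset.range (n + 1)).filter fun i => f i ≠ 0) (fun i => o i - (v.sgn : ℤ) * i)
    (by obtain ⟨i, hi, h⟩ := hf; exact ⟨i, by simp [h]; lia⟩)
  simp only [Finset.mem_filter, Finset.mem_range] at hj hmin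
  have key : ∀ i, ∃ a, i < n + 1 → (v.HasValue
      (v.w ^ (-(o j - (v.sgn : ℤ) * j + (v.sgn : ℤ) * i)) * f i) a ∧ (i = j → a ≠ 0)) := by
    intro i
    by_cases h0 : f i = 0
    · exact ⟨0, fun hi => ⟨by simpa [h0] using v.zero, fun h => absurd h0 (h ▸ hj.2)⟩⟩
    · by_cases hi : i < n + 1
      · rcases (hmin i ⟨hi, h0⟩).lt_or_eq with h | h
        · exact ⟨0, fun _ => ⟨v.zpow_mul (by lia) (ho i h0),
            fun hij => by subst hij; exact absurd h (lt_irrefl _)⟩⟩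
        · refine ⟨l i, fun _ => ⟨?_, fun _ => hl i h0⟩⟩
          convert ho i h0 using 3
          lia
      · exact ⟨0, fun h => absurd h hi⟩
  choose c hc using key
  exact ⟨_, c, ⟨j, hj.1, (hc j hj.1).2 rfl⟩, fun i hi => (hc i hi).1⟩

end Indicial

/-! ### Factors of an operator and their exponents -/

section Factor

variable {K : Type*} [Field K]

theorem comp_ne_zero {P Q : K[X]} (hP : P ≠ 0) (hQ : Q.natDegree = 1) : P.comp Q ≠ 0 := by
  intro h0
  rcases comp_eq_zero_iff.mp h0 with h1 | ⟨-, h1⟩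
  · exact hP h1
  · rw [h1, natDegree_C] at hQ
    exact zero_ne_one hQ

/-- If the indicial polynomial of an operator at a place has the full degree, then the place is
regular singular or ordinary: the coefficients, divided by the leading one, have poles of bounded
order. Moreover the indicial polynomial is given by their leading terms. -/
theorem Place.IsIndicial.coeff_of_natDegree_eq [CharZero K] {v : Place K} {n : ℕ}
    {f : ℕ → RatFunc K} {e : ℤ} {P : K[X]}
    (h : v.IsIndicial (∑ i ∈ Finset.range (n + 1), FuchsODE.mulOp (f i) * FuchsODE.del K ^ i) e P)
    (hP : P ≠ 0) (hn : P.natDegree = n) (hf : f n ≠ 0) :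
    ∃ c : ℕ → K, c n ≠ 0 ∧
      (∀ i < n + 1, v.HasValue (v.w ^ ((v.sgn : ℤ) * (n - i)) * (f i / f n)) (c i / c n)) ∧
      P = (∑ i ∈ Finset.range (n + 1), C (c i) * descPochhammer K i).comp
        (C ((v.sgn : ℤ) : K) * X) := by
  obtain ⟨d, c, hc, hv⟩ := v.exists_normalForm n f ⟨n, by simp, hf⟩
  have hQ := Place.IsIndicial.of_coeff hv
  set Q := ∑ i ∈ Finset.range (n + 1), C (c i) * descPochhammer K i with hQdef
  have hQ0 : Q ≠ 0 := sum_descPochhammer_ne_zero hc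
  have hdeg : (C ((v.sgn : ℤ) : K) * X).natDegree = 1 := natDegree_C_mul_X _ v.sgn_ne_zero
  have hQ1 : Q.comp (C ((v.sgn : ℤ) : K) * X) ≠ 0 := comp_ne_zero hQ0 hdeg
  have hPQ := h.unique hQ hP hQ1
  have hcn : c n ≠ 0 := by
    rw [← coeff_sum_descPochhammer n c, ← hQdef]
    have h1 : Q.natDegree = n := by
      rw [← hn, hPQ, natDegree_comp, hdeg, mul_one]
    rw [← h1]
    exact leadingCoeff_ne_zero.mpr hQ0
  refine ⟨c, hcn, fun i hi => ?_, hPQ⟩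
  have h1 := v.mul (hv i hi) (v.inv (hv n (by simp)) hcn)
  rw [div_eq_mul_inv (c i)]
  convert h1 using 1
  have hw := v.w_ne_zero
  rw [mul_inv, ← zpow_neg, mul_mul_mul_comm, ← zpow_add₀ hw, div_eq_mul_inv]
  congr 2
  ring

/-- The sum of the exponents at a place, in terms of the residue of the subleading coefficient. -/
theorem Place.IsIndicial.sum_roots [CharZero K] [IsAlgClosed K] {v : Place K} {n : ℕ}
    {f : ℕ → RatFunc K} {e : ℤ} {P : K[X]}
    (h : v.IsIndicial
      (∑ i ∈ Finset.range (n + 1 + 1), FuchsODE.mulOp (f i) * FuchsODE.del K ^ i) e P)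
    (hP : P ≠ 0) (hn : P.natDegree = n + 1) (hf : f (n + 1) ≠ 0) :
    v.HasValue (v.w ^ (v.sgn : ℤ) * (f n / f (n + 1)))
      (n * (n + 1) / 2 - (v.sgn : ℤ) * P.roots.sum) := by
  obtain ⟨c, hc, hv, hPQ⟩ := h.coeff_of_natDegree_eq hP hn hf
  have h1 := hv n (by lia)
  have hlead : P.leadingCoeff = c (n + 1) * ((v.sgn : ℤ) : K) ^ (n + 1) := by
    rw [leadingCoeff, hn, hPQ, comp_C_mul_X_coeff, coeff_sum_descPochhammer]
  have hnext : P.nextCoeff =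
      (c n - c (n + 1) * (n * (n + 1) / 2)) * ((v.sgn : ℤ) : K) ^ n := by
    rw [nextCoeff_of_natDegree_pos (by lia), hn, hPQ, comp_C_mul_X_coeff, Nat.add_sub_cancel,
      coeff_pred_sum_descPochhammer]
  have h2 := (IsAlgClosed.splits P).nextCoeff_eq_neg_sum_roots_mul_leadingCoeff
  rw [hlead, hnext] at h2
  have hs := v.sgn_ne_zero
  have h3 : c n - c (n + 1) * (n * (n + 1) / 2) =
      -(c (n + 1) * (v.sgn : ℤ) * P.roots.sum) := by
    apply mul_right_cancel₀ (pow_ne_zero n hs)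
    rw [h2]
    ring
  convert h1 using 1
  · push_cast; congr 2; ring
  · rw [eq_div_iff hc]
    linear_combination -h3

theorem HasOrder.exists_indicial {L : Module.End K (RatFunc K)} {n : ℕ} (h : HasOrder L n)
    (v : Place K) : ∃ (e : ℤ) (P : K[X]), v.IsIndicial L e P ∧ P ≠ 0 ∧ P.natDegree ≤ n := by
  obtain ⟨f, hf, rfl⟩ := h
  obtain ⟨d, c, hc, hv⟩ := v.exists_normalForm n f ⟨n, by simp, hf⟩
  refine ⟨d, _, Place.IsIndicial.of_coeff hv, comp_ne_zero (sum_descPochhammer_ne_zero hc)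
    (natDegree_C_mul_X _ v.sgn_ne_zero), ?_⟩
  rw [natDegree_comp, natDegree_C_mul_X _ v.sgn_ne_zero, mul_one]
  exact natDegree_sum_descPochhammer_le n c

/-- At all but finitely many points the indicial polynomial has the order of the operator as its
degree. -/
theorem HasOrder.exists_generic {L : Module.End K (RatFunc K)} {n : ℕ} (h : HasOrder L n) :
    ∃ D : K[X], D ≠ 0 ∧ ∀ c, D.eval c ≠ 0 → ∃ (e : ℤ) (P : K[X]),
      (finitePlace c).IsIndicial L e P ∧ P ≠ 0 ∧ P.natDegree = n := by
  obtain ⟨f, hf, rfl⟩ := h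
  refine ⟨(∏ i ∈ Finset.range (n + 1), (f i).denom) * (f n).num, mul_ne_zero
    (Finset.prod_ne_zero_iff.mpr fun i _ => RatFunc.denom_ne_zero _) (RatFunc.num_ne_zero hf),
    fun c hc => ?_⟩
  rw [eval_mul, eval_prod] at hc
  have hd := Finset.prod_ne_zero_iff.mp (left_ne_zero_of_mul hc)
  have hv : ∀ i < n + 1, (finitePlace c).HasValue (f i)
      ((f i).num.eval c / (f i).denom.eval c) := by
    intro i hi
    have h0 := hd i (Finset.mem_range.mpr hi)
    exact ⟨(f i).num, (f i).denom, h0, ((div_eq_iff (RatFunc.algebraMap_ne_zero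
      (f i).denom_ne_zero)).mp (RatFunc.num_div_denom (f i))).symm, (div_mul_cancel₀ _ h0).symm⟩
  set a := (f n).num.eval c / (f n).denom.eval c with ha
  have ha0 : a ≠ 0 := div_ne_zero (right_ne_zero_of_mul hc) (hd n (by simp))
  have hw : ∀ i < n + 1, (finitePlace c).HasValue ((finitePlace c).w ^
      (-(-(n : ℤ) + ((finitePlace c).sgn : ℤ) * i)) * f i) (if i = n then a else 0) := by
    intro i hi
    have hs : ((finitePlace c).sgn : ℤ) = 1 := rfl
    rw [hs, one_mul]
    split_ifs with hin
    · subst hin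
      simpa using hv i hi
    · exact (finitePlace c).zpow_mul (e := 0) (by lia) (by simpa using hv i hi)
  refine ⟨_, _, Place.IsIndicial.of_coeff hw, ?_⟩
  have hX : (C (((finitePlace c).sgn : ℤ) : K) * X).comp X = X := by
    have hs : ((finitePlace c).sgn : ℤ) = 1 := rfl
    simp [hs]
  rw [comp_X] at hX
  rw [hX, comp_X]
  simp only [apply_ite C, C_0, ite_mul, zero_mul, Finset.sum_ite_eq', Finset.mem_range,
    Nat.lt_succ_self, if_true]
  refine ⟨mul_ne_zero (C_ne_zero.mpr ha0) (monic_descPochhammer K n).ne_zero, ?_⟩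
  rw [natDegree_C_mul ha0, descPochhammer_natDegree]

theorem comp_shift_mul {P₁ P₂ : K[X]} {e : ℤ} (h₁ : P₁ ≠ 0)
    (h₂ : P₂ ≠ 0) : P₁.comp (X + C (e : K)) * P₂ ≠ 0 ∧
      (P₁.comp (X + C (e : K)) * P₂).natDegree = P₁.natDegree + P₂.natDegree := by
  have h := comp_ne_zero h₁ (natDegree_X_add_C (e : K))
  refine ⟨mul_ne_zero h h₂, ?_⟩
  rw [natDegree_mul h h₂, natDegree_comp, natDegree_X_add_C, mul_one]

theorem HasOrder.eq_add_of_mul [CharZero K] {L₁ L₂ : Module.End K (RatFunc K)} {n n₁ n₂ : ℕ}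
    (h : HasOrder (L₁ * L₂) n) (h₁ : HasOrder L₁ n₁) (h₂ : HasOrder L₂ n₂) : n = n₁ + n₂ := by
  obtain ⟨D, hD, hc⟩ := h.exists_generic
  obtain ⟨D₁, hD₁, hc₁⟩ := h₁.exists_generic
  obtain ⟨D₂, hD₂, hc₂⟩ := h₂.exists_generic
  obtain ⟨c, h0⟩ : ∃ c, (D * D₁ * D₂).eval c ≠ 0 := by
    by_contra! h
    exact mul_ne_zero (mul_ne_zero hD hD₁) hD₂ (Polynomial.funext (by simpa using h))
  rw [eval_mul, eval_mul] at h0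
  obtain ⟨e, P, hP, hP0, hn⟩ := hc c (left_ne_zero_of_mul (left_ne_zero_of_mul h0))
  obtain ⟨e₁, P₁, hP₁, hP₁0, hn₁⟩ := hc₁ c (right_ne_zero_of_mul (left_ne_zero_of_mul h0))
  obtain ⟨e₂, P₂, hP₂, hP₂0, hn₂⟩ := hc₂ c (right_ne_zero_of_mul h0)
  have h3 := comp_shift_mul (e := e₂) hP₁0 hP₂0
  rw [← hn, hP.unique (hP₁.mul hP₂) hP0 h3.1, h3.2, hn₁, hn₂]

/-- The exponents of a right factor of an operator at an ordinary or regular singular point are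
exponents of the operator. -/
theorem Place.IsIndicial.exists_of_mul [CharZero K] {v : Place K}
    {L₁ L₂ : Module.End K (RatFunc K)} {n₁ n₂ : ℕ} {e : ℤ} {P : K[X]}
    (h : v.IsIndicial (L₁ * L₂) e P) (hP : P ≠ 0) (hn : P.natDegree = n₁ + n₂)
    (h₁ : HasOrder L₁ n₁) (h₂ : HasOrder L₂ n₂) :
    ∃ (e₂ : ℤ) (P₂ : K[X]), v.IsIndicial L₂ e₂ P₂ ∧ P₂ ≠ 0 ∧ P₂.natDegree = n₂ ∧ P₂ ∣ P := by
  obtain ⟨e₁, P₁, hP₁, hP₁0, hn₁⟩ := h₁.exists_indicial v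
  obtain ⟨e₂, P₂, hP₂, hP₂0, hn₂⟩ := h₂.exists_indicial v
  have h3 := comp_shift_mul (e := e₂) hP₁0 hP₂0
  have h4 := h.unique (hP₁.mul hP₂) hP h3.1
  refine ⟨e₂, P₂, hP₂, hP₂0, ?_, h4 ▸ dvd_mul_left _ _⟩
  rw [h4, h3.2] at hn
  lia

end Factor

/-! ### The residue theorem for simple poles -/

section Residue

variable {K : Type*} [Field K]

theorem hasValue_infinitePlace_algebraMap {n : ℕ} {p : K[X]} (hp : p.natDegree ≤ n) :
    (infinitePlace K).HasValue ((infinitePlace K).w ^ n * algebraMap K[X] (RatFunc K) p)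
      (p.coeff n) := by
  have hw : (infinitePlace K).w = (RatFunc.X : RatFunc K)⁻¹ := rfl
  have h1 : (infinitePlace K).w ^ n * algebraMap K[X] (RatFunc K) p =
      ∑ i ∈ Finset.range (n + 1), RatFunc.C (p.coeff i) * (infinitePlace K).w ^ (n - i) := by
    conv_lhs => rw [p.as_sum_range_C_mul_X_pow' (Nat.lt_succ_of_le hp)]
    rw [map_sum, Finset.mul_sum]
    refine Finset.sum_congr rfl fun i hi => ?_
    have hi' : i ≤ n := Nat.lt_succ_iff.mp (Finset.mem_range.mp hi)
    have hX : (RatFunc.X : RatFunc K) ≠ 0 := RatFunc.X_ne_zero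
    rw [map_mul, map_pow, RatFunc.algebraMap_C, RatFunc.algebraMap_X, hw, inv_pow, inv_pow,
      ← Nat.sub_add_cancel hi', pow_add, Nat.add_sub_cancel]
    field_simp
  have h2 := (infinitePlace K).sum (Finset.range (n + 1)) (fun i _ =>
    (infinitePlace K).mul ((infinitePlace K).const (p.coeff i))
      ((infinitePlace K).pow (infinitePlace K).unif (n - i)))
  rw [← h1, Finset.sum_range_succ, Finset.sum_eq_zero] at h2
  · simpa using h2
  · intro i hi
    rw [zero_pow (by have := Finset.mem_range.mp hi; lia), mul_zero]

theorem hasValueAt_inv_X_sub_C {c d : K} (h : c ≠ d) :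
    HasValueAt c (RatFunc.X - RatFunc.C d)⁻¹ (c - d)⁻¹ := by
  have h1 := hasValueAt_algebraMap c (X - C d)
  rw [map_sub, RatFunc.algebraMap_X, RatFunc.algebraMap_C, eval_sub, eval_X, eval_C] at h1
  exact h1.inv (sub_ne_zero.mpr h)

/-- A rational function with at most simple poles that vanishes at infinity: the residues at finite
points add up to the leading coefficient at infinity. -/
theorem exists_sum_residue [IsAlgClosed K] {b : RatFunc K} {β : K → K} {β' : K}
    (hβ : ∀ c, HasValueAt c ((RatFunc.X - RatFunc.C c) * b) (β c))
    (hβ' : (infinitePlace K).HasValue (RatFunc.X * b) β') (T : Finset K) :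
    ∃ S, T ⊆ S ∧ β' = ∑ c ∈ S, β c := by
  classical
  refine ⟨T ∪ b.denom.roots.toFinset, Finset.subset_union_left, ?_⟩
  set S := T ∪ b.denom.roots.toFinset with hS
  set g := b - ∑ c ∈ S, RatFunc.C (β c) * (RatFunc.X - RatFunc.C c)⁻¹ with hg
  have hneg : ∀ (v : Place K) {x y : RatFunc K} {a b : K}, v.HasValue x a → v.HasValue y b →
      v.HasValue (x - y) (a - b) := by
    intro v x y a b hx hy
    have := v.add hx (v.mul (v.const (-1)) hy)
    simpa [sub_eq_add_neg] using this
  have hreg : ∀ c, ∃ a, HasValueAt c g a := by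
    intro c
    by_cases hc : c ∈ S
    · apply HasValueAt.of_mul
      have h1 : (RatFunc.X - RatFunc.C c) * g = (RatFunc.X - RatFunc.C c) * b -
          ∑ d ∈ S, RatFunc.C (β d) *
            ((RatFunc.X - RatFunc.C c) * (RatFunc.X - RatFunc.C d)⁻¹) := by
        rw [hg, mul_sub, Finset.mul_sum]
        congr 1
        exact Finset.sum_congr rfl fun d _ => by ring
      have h2 : ∀ d ∈ S, (finitePlace c).HasValue (RatFunc.C (β d) *
          ((RatFunc.X - RatFunc.C c) * (RatFunc.X - RatFunc.C d)⁻¹))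
          (if d = c then β c else 0) := by
        intro d _
        split_ifs with hdc
        · subst hdc
          rw [mul_inv_cancel₀ (ratFunc_X_sub_C_ne_zero d), mul_one]
          exact hasValueAt_C d _
        · have := (hasValueAt_C c (β d)).mul
            ((hasValueAt_unif c).mul (hasValueAt_inv_X_sub_C (Ne.symm hdc)))
          rwa [zero_mul, mul_zero] at this
      have h3 := hneg (finitePlace c) (hβ c) ((finitePlace c).sum S h2)
      rw [Finset.sum_ite_eq', if_pos hc, sub_self] at h3
      rw [h1]
      exact h3
    · have hb : IsRegularAt b c := by
        intro h0
        apply hc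
        simp [hS, RatFunc.denom_ne_zero, h0]
      obtain ⟨a, ha⟩ := isRegularAt_iff.mp hb
      have h2 : ∀ d ∈ S, (finitePlace c).HasValue
          (RatFunc.C (β d) * (RatFunc.X - RatFunc.C d)⁻¹) (β d * (c - d)⁻¹) := fun d hd =>
        (hasValueAt_C c (β d)).mul (hasValueAt_inv_X_sub_C fun h => hc (h ▸ hd))
      exact ⟨_, hneg (finitePlace c) ha ((finitePlace c).sum S h2)⟩
  -- without finite poles, `g` is a polynomial
  have hpoly : g = algebraMap K[X] (RatFunc K) g.num := by
    have h1 : g.denom.natDegree = 0 := by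
      by_contra h
      obtain ⟨c, hc⟩ := IsAlgClosed.exists_root g.denom
        (fun h0 => h (natDegree_eq_of_degree_eq_some h0))
      exact isRegularAt_iff.mpr (hreg c) hc
    have h2 := (RatFunc.monic_denom g : g.denom.Monic).natDegree_eq_zero.mp h1
    conv_lhs => rw [← RatFunc.num_div_denom g, h2, map_one, div_one]
  have hinf : (infinitePlace K).HasValue (RatFunc.X * g) (β' - ∑ c ∈ S, β c) := by
    have h1 : RatFunc.X * g = RatFunc.X * b -
        ∑ d ∈ S, RatFunc.C (β d) * (RatFunc.X * (RatFunc.X - RatFunc.C d)⁻¹) := by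
      rw [hg, mul_sub, Finset.mul_sum]
      congr 1
      exact Finset.sum_congr rfl fun d _ => by ring
    rw [h1]
    refine hneg _ hβ' ((infinitePlace K).sum S fun d _ => ?_)
    have h2 := hasValue_infinitePlace_algebraMap (n := 1) (natDegree_X_sub_C_le d)
    have h3 := (infinitePlace K).inv h2 (by simp)
    have h4 := (infinitePlace K).mul ((infinitePlace K).const (β d)) h3
    have hw : (infinitePlace K).w = (RatFunc.X : RatFunc K)⁻¹ := rfl
    simpa [hw, mul_comm (RatFunc.X : RatFunc K)] using h4
  -- a polynomial `g` with `t g` regular at infinity vanishes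
  have hg0 : g = 0 := by
    have h1 := hasValue_infinitePlace_algebraMap (le_refl g.num.natDegree)
    have h2 := (infinitePlace K).mul
      ((infinitePlace K).pow (infinitePlace K).unif (g.num.natDegree + 1)) hinf
    have hw : (infinitePlace K).w = (RatFunc.X : RatFunc K)⁻¹ := rfl
    have hX : (RatFunc.X : RatFunc K) ≠ 0 := RatFunc.X_ne_zero
    have h3 : (infinitePlace K).w ^ (g.num.natDegree + 1) * (RatFunc.X * g) =
        (infinitePlace K).w ^ g.num.natDegree * g := by
      rw [hw, pow_succ]; field_simp
    rw [h3] at h2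
    rw [← hpoly] at h1
    have h4 := (infinitePlace K).unique h1 h2
    rw [zero_pow (by lia), zero_mul, coeff_natDegree, leadingCoeff_eq_zero] at h4
    rw [hpoly, h4, map_zero]
  rw [hg0, mul_zero] at hinf
  exact sub_eq_zero.mp ((infinitePlace K).unique hinf (infinitePlace K).zero)

end Residue

/-! ### Ordinary and regular singular points -/

section Criteria

variable {K : Type*} [Field K]

theorem mulOp_mul (f g : RatFunc K) : mulOp (f * g) = mulOp f * mulOp g :=
  LinearMap.ext fun h => mul_assoc f g h

theorem mulOp_one : mulOp (1 : RatFunc K) = 1 := LinearMap.ext fun h => one_mul h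

theorem mulOp_zero : mulOp (0 : RatFunc K) = 0 := LinearMap.ext fun h => zero_mul h

theorem mulOp_apply (f g : RatFunc K) : mulOp f g = f * g := rfl

theorem del_apply (f : RatFunc K) : del K f = ddt K f := rfl

/-- Division of an operator by its leading coefficient. -/
theorem sum_eq_mulOp_mul {n : ℕ} {f : ℕ → RatFunc K} (hf : f n ≠ 0) :
    ∑ i ∈ Finset.range (n + 1), mulOp (f i) * del K ^ i =
      mulOp (f n) * (del K ^ n + ∑ i ∈ Finset.range n, mulOp (f i / f n) * del K ^ i) := by
  rw [Finset.sum_range_succ, mul_add, Finset.mul_sum, add_comm]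
  congr 1
  refine Finset.sum_congr rfl fun i _ => ?_
  rw [← mul_assoc, ← mulOp_mul, mul_div_cancel₀ _ hf]

theorem HasOrder.isFuchsianFin [CharZero K] {L : Module.End K (RatFunc K)} {n : ℕ} {c : K} {e : ℤ}
    {P : K[X]} (hL : HasOrder L n) (h : (finitePlace c).IsIndicial L e P) (hP : P ≠ 0)
    (hn : P.natDegree = n) : IsFuchsianFin L c := by
  obtain ⟨f, hf, rfl⟩ := hL
  obtain ⟨a, -, hv, -⟩ := h.coeff_of_natDegree_eq hP hn hf
  refine ⟨n, f n, fun i => f i / f n, hf, sum_eq_mulOp_mul hf, fun i hi => ?_⟩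
  have h1 := hv i (by lia)
  have h2 : (finitePlace c).w ^ (((finitePlace c).sgn : ℤ) * ((n : ℤ) - i)) =
      (RatFunc.X - RatFunc.C c) ^ (n - i) := by
    rw [← zpow_natCast, Nat.cast_sub hi.le]
    change (RatFunc.X - RatFunc.C c) ^ ((((1 : ℤˣ)) : ℤ) * _) = _
    simp
  rw [h2] at h1
  exact isRegularAt_iff.mpr ⟨_, h1⟩

theorem exists_nat_of_descPochhammer_eval_eq_zero {n : ℕ} {r : K}
    (h : (descPochhammer K n).eval r = 0) : ∃ m : ℕ, r = m := by
  induction n with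
  | zero => simp at h
  | succ n ih =>
    rw [descPochhammer_succ_eval] at h
    rcases mul_eq_zero.mp h with h | h
    · exact ih h
    · exact ⟨n, sub_eq_zero.mp h⟩

/-- The exponents at an ordinary point of an operator of order `n` are `0, 1, …, n - 1`. -/
theorem IsOrdinaryFin.exists_isIndicial {L : Module.End K (RatFunc K)} {c : K}
    (h : IsOrdinaryFin L c) : ∃ (n : ℕ) (e : ℤ) (a : K), a ≠ 0 ∧
      (finitePlace c).IsIndicial L e (C a * descPochhammer K n) := by
  obtain ⟨n, p, q, hp, rfl, hq⟩ := h
  obtain ⟨d, a, ha, hpv⟩ := (finitePlace c).exists_order hp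
  refine ⟨n, d + -n, a, ha, ?_⟩
  have hs : ((finitePlace c).sgn : ℤ) = 1 := rfl
  have hv : ∀ i < n + 1, (finitePlace c).HasValue ((finitePlace c).w ^
      (-(-(n : ℤ) + ((finitePlace c).sgn : ℤ) * i)) * (if i < n then q i else 1))
      (if i = n then 1 else 0) := by
    intro i hi
    rw [hs, one_mul]
    rcases (Nat.lt_succ_iff.mp hi).lt_or_eq with h | rfl
    · rw [if_pos h, if_neg h.ne]
      obtain ⟨b, hb⟩ := isRegularAt_iff.mp (hq i h)
      have hb' : (finitePlace c).HasValue (q i) b := hb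
      exact (finitePlace c).zpow_mul (e := 0) (by lia) (by simpa using hb')
    · simpa using (finitePlace c).one
  have h1 := Place.IsIndicial.of_coeff hv
  have h2 : ∑ i ∈ Finset.range (n + 1), mulOp (if i < n then q i else 1) * del K ^ i =
      del K ^ n + ∑ i ∈ Finset.range n, mulOp (q i) * del K ^ i := by
    rw [Finset.sum_range_succ, if_neg (lt_irrefl n), mulOp_one, one_mul, add_comm]
    congr 1
    exact Finset.sum_congr rfl fun i hi => by rw [if_pos (Finset.mem_range.mp hi)]
  rw [h2] at h1
  convert (Place.IsIndicial.mulOp hpv).mul h1 using 1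
  simp [hs]

theorem not_isOrdinaryFin [CharZero K] {L : Module.End K (RatFunc K)} {c : K} {e : ℤ} {P : K[X]}
    (h : (finitePlace c).IsIndicial L e P) (hP : P ≠ 0) {r : K} (hr : P.eval r = 0)
    (hr' : ∀ m : ℤ, r ≠ m) : ¬ IsOrdinaryFin L c := by
  intro h0
  obtain ⟨n, d, a, ha, h1⟩ := h0.exists_isIndicial
  rw [h.unique h1 hP (mul_ne_zero (C_ne_zero.mpr ha) (monic_descPochhammer K n).ne_zero),
    eval_mul, eval_C] at hr
  obtain ⟨m, hm⟩ := exists_nat_of_descPochhammer_eval_eq_zero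
    ((mul_eq_zero.mp hr).resolve_left ha)
  exact hr' m (by simpa using hm)

end Criteria

/-! ### The coordinate `1/t` -/

section Infinity

variable {K : Type*} [Field K]

theorem atInfinity_apply (L : Module.End K (RatFunc K)) (f : RatFunc K) :
    atInfinity L f = inversion K (L (inversion K f)) := rfl

theorem Place.IsIndicial.atInfinity {L : Module.End K (RatFunc K)} {e : ℤ} {P : K[X]}
    (h : (infinitePlace K).IsIndicial L e P) :
    (finitePlace (0 : K)).IsIndicial (FuchsODE.atInfinity L) e P := by
  have hw : (finitePlace (0 : K)).w = RatFunc.X := by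
    change RatFunc.X - RatFunc.C 0 = _
    simp
  have key : ∀ (k : ℤ) (f : RatFunc K) (a : K),
      (infinitePlace K).HasValue ((infinitePlace K).w ^ k * f) a ↔
        (finitePlace (0 : K)).HasValue ((finitePlace (0 : K)).w ^ k * inversion K f) a := by
    intro k f a
    rw [hw]
    change HasValueAt 0 (inversion K (RatFunc.X⁻¹ ^ k * f)) a ↔
      HasValueAt 0 (RatFunc.X ^ k * inversion K f) a
    rw [map_mul, map_zpow₀, map_inv₀, inversion_X, inv_inv]
  intro s f a hf
  rw [atInfinity_apply, ← key]
  apply h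
  rwa [key, inversion_inversion]

/-- `L` is an operator of order at most `n`, and `a` is its coefficient at `∂ⁿ`. -/
def HasTopCoeff (L : Module.End K (RatFunc K)) (n : ℕ) (a : RatFunc K) : Prop :=
  ∃ f : ℕ → RatFunc K, f n = a ∧ L = ∑ i ∈ Finset.range (n + 1), mulOp (f i) * del K ^ i

theorem HasTopCoeff.add {L L' : Module.End K (RatFunc K)} {n : ℕ} {a a' : RatFunc K}
    (h : HasTopCoeff L n a) (h' : HasTopCoeff L' n a') : HasTopCoeff (L + L') n (a + a') := by
  obtain ⟨f, rfl, rfl⟩ := h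
  obtain ⟨f', rfl, rfl⟩ := h'
  refine ⟨f + f', rfl, ?_⟩
  rw [← Finset.sum_add_distrib]
  refine Finset.sum_congr rfl fun i _ => LinearMap.ext fun g => ?_
  simp [mulOp_apply, add_mul]

theorem HasTopCoeff.succ {L : Module.End K (RatFunc K)} {n : ℕ} {a : RatFunc K}
    (h : HasTopCoeff L n a) : HasTopCoeff L (n + 1) 0 := by
  obtain ⟨f, rfl, rfl⟩ := h
  refine ⟨fun i => if i < n + 1 then f i else 0, by simp, ?_⟩
  rw [Finset.sum_range_succ _ (n + 1)]
  simp only [lt_irrefl, if_false, mulOp_zero, zero_mul, add_zero]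
  exact Finset.sum_congr rfl fun i hi => by rw [if_pos (Finset.mem_range.mp hi)]

theorem HasTopCoeff.mulOp_mul {L : Module.End K (RatFunc K)} {n : ℕ} {a : RatFunc K}
    (h : HasTopCoeff L n a) (g : RatFunc K) : HasTopCoeff (mulOp g * L) n (g * a) := by
  obtain ⟨f, rfl, rfl⟩ := h
  refine ⟨fun i => g * f i, rfl, ?_⟩
  rw [Finset.mul_sum]
  exact Finset.sum_congr rfl fun i _ => by rw [FuchsODE.mulOp_mul, mul_assoc]

theorem HasTopCoeff.del_mul {L : Module.End K (RatFunc K)} {n : ℕ} {a : RatFunc K}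
    (h : HasTopCoeff L n a) : HasTopCoeff (del K * L) (n + 1) a := by
  obtain ⟨f, rfl, rfl⟩ := h
  have h1 : HasTopCoeff (∑ i ∈ Finset.range (n + 1), mulOp (ddt K (f i)) * del K ^ i) (n + 1) 0 :=
    HasTopCoeff.succ ⟨fun i => ddt K (f i), rfl, rfl⟩
  have h2 : HasTopCoeff (∑ i ∈ Finset.range (n + 1), mulOp (f i) * del K ^ (i + 1)) (n + 1)
      (f n) := by
    refine ⟨fun i => if i = 0 then 0 else f (i - 1), by simp, ?_⟩
    rw [Finset.sum_range_succ' _ (n + 1)]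
    simp [mulOp_zero]
  convert h1.add h2 using 1
  · rw [Finset.mul_sum, ← Finset.sum_add_distrib]
    refine Finset.sum_congr rfl fun i _ => LinearMap.ext fun g => ?_
    rw [pow_succ']
    simp only [Module.End.mul_apply, mulOp_apply, del_apply, Derivation.leibniz, smul_eq_mul,
      LinearMap.add_apply]
    ring
  · rw [zero_add]

theorem hasTopCoeff_pow (g : RatFunc K) (n : ℕ) :
    HasTopCoeff ((mulOp g * del K) ^ n) n (g ^ n) := by
  induction n with
  | zero => exact ⟨fun _ => 1, by simp, by simp [mulOp_one]⟩
  | succ n ih =>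
    rw [pow_succ', pow_succ', mul_assoc]
    exact ih.del_mul.mulOp_mul g

theorem atInfinity_mulOp_mul_del_pow (f : RatFunc K) (n : ℕ) :
    atInfinity (mulOp f * del K ^ n) =
      mulOp (inversion K f) * (mulOp (-RatFunc.X ^ 2) * del K) ^ n := by
  have h : ∀ g : RatFunc K, inversion K ((del K ^ n) (inversion K g)) =
      ((mulOp (-RatFunc.X ^ 2) * del K) ^ n : Module.End K (RatFunc K)) g := by
    induction n with
    | zero => intro g; simp [inversion_inversion]
    | succ n ih =>
      intro g
      rw [pow_succ', pow_succ', Module.End.mul_apply, Module.End.mul_apply, ← ih,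
        Module.End.mul_apply, mulOp_apply, del_apply, del_apply, ddt_inversion]
      have hX : (RatFunc.X : RatFunc K) ≠ 0 := RatFunc.X_ne_zero
      field_simp
  refine LinearMap.ext fun g => ?_
  rw [atInfinity_apply, Module.End.mul_apply, mulOp_apply, map_mul, h]
  rfl

theorem HasOrder.atInfinity {L : Module.End K (RatFunc K)} {n : ℕ} (h : HasOrder L n) :
    HasOrder (atInfinity L) n := by
  obtain ⟨f, hf, rfl⟩ := h
  have h1 : ∀ m, HasTopCoeff (∑ i ∈ Finset.range (m + 1),
      FuchsODE.atInfinity (mulOp (f i) * del K ^ i)) m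
      (inversion K (f m) * (-RatFunc.X ^ 2) ^ m) := by
    intro m
    induction m with
    | zero =>
      rw [zero_add, Finset.sum_range_one, atInfinity_mulOp_mul_del_pow]
      exact (hasTopCoeff_pow _ 0).mulOp_mul _
    | succ m ih =>
      rw [Finset.sum_range_succ, atInfinity_mulOp_mul_del_pow, ← zero_add (inversion K _ * _)]
      exact ih.succ.add ((hasTopCoeff_pow _ _).mulOp_mul _)
  obtain ⟨g, hg, h2⟩ := h1 n
  refine ⟨g, ?_, ?_⟩
  · rw [hg]
    exact mul_ne_zero (inversion_ne_zero hf)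
      (pow_ne_zero _ (neg_ne_zero.mpr (pow_ne_zero _ RatFunc.X_ne_zero)))
  · rw [← h2]
    refine LinearMap.ext fun x => ?_
    simp only [LinearMap.sum_apply, atInfinity_apply, map_sum]

end Infinity

/-! ### Right factors and the sums of their exponents -/

section RightFactor

variable {K : Type*} [Field K] [CharZero K] [IsAlgClosed K]

/-- If the operator `L₁ L₂` has the exponents `R` at a place, then the exponents of the right factor
`L₂` form a submultiset `s`, whose sum gives the residue of the subleading coefficient of `L₂`. -/
theorem Place.IsIndicial.exists_exponents {v : Place K} {L₁ : Module.End K (RatFunc K)}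
    {n₁ k : ℕ} {f : ℕ → RatFunc K} {e : ℤ} {κ : K} {R : Multiset K}
    (h : v.IsIndicial
      (L₁ * ∑ i ∈ Finset.range (k + 1 + 1), FuchsODE.mulOp (f i) * FuchsODE.del K ^ i) e
      (C κ * (R.map fun r => X - C r).prod))
    (hκ : κ ≠ 0) (h₁ : HasOrder L₁ n₁) (hf : f (k + 1) ≠ 0) (hn : n₁ + (k + 1) = R.card) :
    ∃ s ≤ R, s.card = k + 1 ∧ v.HasValue (v.w ^ (v.sgn : ℤ) * (f k / f (k + 1)))
      (k * (k + 1) / 2 - (v.sgn : ℤ) * s.sum) := by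
  have hm : (R.map fun r => X - C r).prod.Monic := monic_multiset_prod_of_monic _ _
    fun r _ => monic_X_sub_C r
  have h0 : C κ * (R.map fun r => X - C r).prod ≠ 0 :=
    mul_ne_zero (C_ne_zero.mpr hκ) hm.ne_zero
  have hdeg : (C κ * (R.map fun r => X - C r).prod).natDegree = n₁ + (k + 1) := by
    rw [natDegree_C_mul hκ, natDegree_multiset_prod_X_sub_C_eq_card, hn]
  obtain ⟨e₂, P, hP, hP0, hk, hdvd⟩ := h.exists_of_mul h0 hdeg h₁ ⟨f, hf, rfl⟩
  refine ⟨P.roots, ?_, ?_, hP.sum_roots hP0 hk hf⟩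
  · have := roots.le_of_dvd h0 hdvd
    rwa [roots_C_mul _ hκ, roots_multiset_prod_X_sub_C] at this
  · rw [← hk]
    exact (IsAlgClosed.splits P).natDegree_eq_card_roots.symm

end RightFactor

/-! ### The exponents of `Z(a)` -/

section ZOperator

variable {K : Type*} [Field K]

/-- The coefficient of `∂ⁱ` in `Z(a)`, for `i ≤ 4`. -/
noncomputable def zPoly (a : Fin 4 → K) : ℕ → K[X]
  | 0 => zCoeff (C (a 0)) (C (a 1)) (C (a 2)) (C (a 3)) X 4
  | 1 => zCoeff (C (a 0)) (C (a 1)) (C (a 2)) (C (a 3)) X 3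
  | 2 => zCoeff (C (a 0)) (C (a 1)) (C (a 2)) (C (a 3)) X 2
  | 3 => zCoeff (C (a 0)) (C (a 1)) (C (a 2)) (C (a 3)) X 1
  | _ => zCoeff (C (a 0)) (C (a 1)) (C (a 2)) (C (a 3)) X 0

theorem Z_eq_sum (a : Fin 4 → K) :
    Z a = ∑ i ∈ Finset.range (4 + 1),
      mulOp (algebraMap K[X] (RatFunc K) (zPoly a i)) * del K ^ i := by
  simp only [Z, Fin.sum_univ_five, Finset.sum_range_succ, Finset.sum_range_zero, zPoly, zCoeff]
  simp [RatFunc.algebraMap_X, RatFunc.algebraMap_C, map_ofNat]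
  abel

theorem finitePlace_hasValue (c : K) (p : K[X]) :
    (finitePlace c).HasValue (algebraMap K[X] (RatFunc K) p) (p.eval c) :=
  hasValueAt_algebraMap c p

theorem finitePlace_hasValue_pow_mul {c : K} {p r : K[X]} {m : ℕ} (h : p = (X - C c) ^ m * r) :
    (finitePlace c).HasValue ((finitePlace c).w ^ (-(m : ℤ)) * algebraMap K[X] (RatFunc K) p)
      (r.eval c) := by
  have hw := (finitePlace c).w_ne_zero
  have h1 : algebraMap K[X] (RatFunc K) p =
      (finitePlace c).w ^ m * algebraMap K[X] (RatFunc K) r := by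
    rw [h, map_mul, map_pow, map_sub, RatFunc.algebraMap_X, RatFunc.algebraMap_C]
    rfl
  rw [h1, zpow_neg, zpow_natCast, inv_mul_cancel_left₀ (pow_ne_zero _ hw)]
  exact finitePlace_hasValue c r

theorem finitePlace_hasValue_zpow_mul {c : K} (p : K[X]) {e : ℤ} (he : e < 0) :
    (finitePlace c).HasValue ((finitePlace c).w ^ (-e) * algebraMap K[X] (RatFunc K) p) 0 :=
  (finitePlace c).zpow_mul he (by simpa using finitePlace_hasValue c p)

variable [CharZero K] {a A : Fin 4 → K}

theorem zPoly_four_ne_zero (a : Fin 4 → K) : zPoly a 4 ≠ 0 := by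
  intro h
  have := congrArg (eval 0) h
  simp [zPoly, zCoeff] at this

theorem hasOrder_Z (a : Fin 4 → K) : HasOrder (Z a) 4 :=
  ⟨_, RatFunc.algebraMap_ne_zero (zPoly_four_ne_zero a), Z_eq_sum a⟩

theorem isIndicial_Z_of_ne (a : Fin 4 → K) {c : K} (h1 : c ≠ 1) (h2 : c ≠ -1) :
    ∃ (e : ℤ) (κ : K), κ ≠ 0 ∧ (finitePlace c).IsIndicial (Z a) e
      (C κ * ((({0, 1, 2, 3} : Multiset K)).map fun r => X - C r).prod) := by
  have hs : ((finitePlace c).sgn : ℤ) = 1 := rfl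
  refine ⟨-4, (zPoly a 4).eval c, ?_, ?_⟩
  · have h3 : c - 1 ≠ 0 := sub_ne_zero.mpr h1
    have h4 : c + 1 ≠ 0 := fun h => h2 (eq_neg_of_add_eq_zero_left h)
    simp [zPoly, zCoeff, h3, h4]
  rw [Z_eq_sum]
  have hv : ∀ i : ℕ, i < 4 + 1 → (finitePlace c).HasValue ((finitePlace c).w ^
      (-(-4 + ((finitePlace c).sgn : ℤ) * i)) * algebraMap K[X] (RatFunc K) (zPoly a i))
      (if i = 4 then (zPoly a 4).eval c else 0) := by
    intro i hi
    rw [hs, one_mul]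
    split_ifs with h
    · subst h
      simpa using finitePlace_hasValue c (zPoly a 4)
    · exact finitePlace_hasValue_zpow_mul _ (by lia)
  convert Place.IsIndicial.of_coeff hv using 1
  refine Polynomial.funext fun r => ?_
  simp [hs, Finset.sum_range_succ, descPochhammer_succ_eval]
  left
  ring

theorem isIndicial_Z_one (ha₀ : a 0 = 2 * A 0 - 3) :
    ∃ (e : ℤ) (κ : K), κ ≠ 0 ∧ (finitePlace (1 : K)).IsIndicial (Z a) e
      (C κ * ((({0, 2 * A 0, A 0 - 1 / 2, A 0 + 1 / 2} : Multiset K)).map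
        fun r => X - C r).prod) := by
  have hs : ((finitePlace (1 : K)).sgn : ℤ) = 1 := rfl
  refine ⟨-1, 8, by norm_num, ?_⟩
  rw [Z_eq_sum]
  have hv : ∀ i : ℕ, i < 4 + 1 → (finitePlace (1 : K)).HasValue ((finitePlace (1 : K)).w ^
      (-(-1 + ((finitePlace (1 : K)).sgn : ℤ) * i)) * algebraMap K[X] (RatFunc K) (zPoly a i))
      (![0, -2 * a 0 * (a 0 + 2) ^ 2, 2 * (5 * a 0 ^ 2 + 6 * a 0), -16 * a 0, 8]
        (Fin.ofNat 5 i)) := by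
    intro i hi
    rw [hs, one_mul]
    interval_cases i
    · exact finitePlace_hasValue_zpow_mul _ (by norm_num)
    · convert finitePlace_hasValue_pow_mul (c := (1 : K)) (p := zPoly a 1) (m := 0)
        (by rw [pow_zero, one_mul]) using 1
      · norm_num
      · change (-2 * a 0 * (a 0 + 2) ^ 2 : K) = _
        simp [zPoly, zCoeff]
        ring
    · convert finitePlace_hasValue_pow_mul (c := (1 : K)) (p := zPoly a 2) (m := 1)
        (r := 2 * ((C (a 0) ^ 2 - 2 * C (a 1) + 6 * C (a 0) + 2 + C (a 2) + C (a 3))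
          + (3 * C (a 0) ^ 2 + 4 * C (a 0) - 4 + 2 * C (a 1)) * X
          + (C (a 0) ^ 2 - 4 * C (a 0) + 2 - C (a 2) - C (a 3)) * X ^ 2))
        (by simp [zPoly, zCoeff]; ring) using 1
      · norm_num
      · change (2 * (5 * a 0 ^ 2 + 6 * a 0) : K) = _
        simp
        ring
    · convert finitePlace_hasValue_pow_mul (c := (1 : K)) (p := zPoly a 3) (m := 2)
        (r := -4 * (X + 1) * ((2 + C (a 0)) + (C (a 0) - 2) * X))
        (by simp [zPoly, zCoeff]; ring) using 1
      · norm_num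
      · change (-16 * a 0 : K) = _
        simp
        ring
    · convert finitePlace_hasValue_pow_mul (c := (1 : K)) (p := zPoly a 4) (m := 3)
        (r := 2 * (X + 1) ^ 2) (by simp [zPoly, zCoeff]; ring) using 1
      · norm_num
      · change (8 : K) = _
        simp
        norm_num
  convert Place.IsIndicial.of_coeff hv using 1
  refine Polynomial.funext fun r => ?_
  simp [hs, Finset.sum_range_succ, descPochhammer_succ_eval, Fin.ofNat, ha₀]
  field_simp
  ring

theorem isIndicial_Z_neg_one (ha₀ : a 0 = 2 * A 0 - 3)
    (ha : ∀ i : Fin 4, i ≠ 0 → a i = A i ^ 2 - (A 0 - 1) ^ 2) :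
    ∃ (e : ℤ) (κ : K), κ ≠ 0 ∧ (finitePlace (-1 : K)).IsIndicial (Z a) e
      (C κ * ((({0, 1, 1 / 2 + A 1, 1 / 2 - A 1} : Multiset K)).map
        fun r => X - C r).prod) := by
  have hs : ((finitePlace (-1 : K)).sgn : ℤ) = 1 := rfl
  refine ⟨-2, -16, by norm_num, ?_⟩
  rw [Z_eq_sum]
  have hv : ∀ i : ℕ, i < 4 + 1 → (finitePlace (-1 : K)).HasValue ((finitePlace (-1 : K)).w ^
      (-(-2 + ((finitePlace (-1 : K)).sgn : ℤ) * i)) * algebraMap K[X] (RatFunc K) (zPoly a i))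
      (![0, 0, 4 * (a 0 ^ 2 + 4 * a 1 + 2 * a 0 - 8), -64, -16] (Fin.ofNat 5 i)) := by
    intro i hi
    rw [hs, one_mul]
    interval_cases i
    · exact finitePlace_hasValue_zpow_mul _ (by norm_num)
    · exact finitePlace_hasValue_zpow_mul _ (by norm_num)
    · convert finitePlace_hasValue_pow_mul (c := (-1 : K)) (p := zPoly a 2) (m := 0)
        (by rw [pow_zero, one_mul]) using 1
      · norm_num
      · change (4 * (a 0 ^ 2 + 4 * a 1 + 2 * a 0 - 8) : K) = _
        simp [zPoly, zCoeff]
        ring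
    · convert finitePlace_hasValue_pow_mul (c := (-1 : K)) (p := zPoly a 3) (m := 1)
        (r := -4 * (X - 1) ^ 2 * ((2 + C (a 0)) + (C (a 0) - 2) * X))
        (by simp [zPoly, zCoeff]; ring) using 1
      · norm_num
      · change (-64 : K) = _
        simp
        ring
    · convert finitePlace_hasValue_pow_mul (c := (-1 : K)) (p := zPoly a 4) (m := 2)
        (r := 2 * (X - 1) ^ 3) (by simp [zPoly, zCoeff]; ring) using 1
      · norm_num
      · change (-16 : K) = _
        simp
        norm_num
  convert Place.IsIndicial.of_coeff hv using 1
  refine Polynomial.funext fun r => ?_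
  simp [hs, Finset.sum_range_succ, descPochhammer_succ_eval, Fin.ofNat, ha₀, ha]
  field_simp
  ring

theorem isIndicial_Z_infinity (ha₀ : a 0 = 2 * A 0 - 3)
    (ha : ∀ i : Fin 4, i ≠ 0 → a i = A i ^ 2 - (A 0 - 1) ^ 2) :
    ∃ (e : ℤ) (κ : K), κ ≠ 0 ∧ (infinitePlace K).IsIndicial (Z a) e
      (C κ * ((({1 - A 0 + A 2, 1 - A 0 - A 2, 1 - A 0 + A 3, 1 - A 0 - A 3} : Multiset K)).map
        fun r => X - C r).prod) := by
  have hs : ((infinitePlace K).sgn : ℤ) = -1 := rfl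
  refine ⟨-1, 2, by norm_num, ?_⟩
  rw [Z_eq_sum]
  have hv : ∀ i : ℕ, i < 4 + 1 → (infinitePlace K).HasValue ((infinitePlace K).w ^
      (-(-1 + ((infinitePlace K).sgn : ℤ) * i)) * algebraMap K[X] (RatFunc K) (zPoly a i))
      (![2 * a 2 * a 3, 2 * a 0 * (a 0 + a 2 + a 3),
        2 * (a 0 ^ 2 - 4 * a 0 + 2 - a 2 - a 3), -4 * (a 0 - 2), 2] (Fin.ofNat 5 i)) := by
    intro i hi
    have hdeg : (zPoly a i).natDegree ≤ i + 1 := by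
      interval_cases i <;> simp only [zPoly, zCoeff] <;> simp <;> compute_degree!
    have h := hasValue_infinitePlace_algebraMap hdeg
    convert h using 1
    · rw [hs, ← zpow_natCast]
      congr 2
      push_cast
      ring
    · symm
      interval_cases i
      · change _ = (2 * a 2 * a 3 : K)
        simp only [zPoly, zCoeff, Matrix.cons_val]
        compute_degree!
      · change _ = (2 * a 0 * (a 0 + a 2 + a 3) : K)
        simp only [zPoly, zCoeff, Matrix.cons_val]
        compute_degree!
      · change _ = (2 * (a 0 ^ 2 - 4 * a 0 + 2 - a 2 - a 3) : K)
        simp only [zPoly, zCoeff, Matrix.cons_val]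
        compute_degree!
      · change _ = (-4 * (a 0 - 2) : K)
        simp only [zPoly, zCoeff, Matrix.cons_val]
        compute_degree!
      · change _ = (2 : K)
        simp only [zPoly, zCoeff, Matrix.cons_val]
        compute_degree!
  convert Place.IsIndicial.of_coeff hv using 1
  refine Polynomial.funext fun r => ?_
  simp [hs, Finset.sum_range_succ, descPochhammer_succ_eval, Fin.ofNat, ha₀, ha]
  ring

end ZOperator

/-! ### Sums of exponents modulo the integers -/

section Exponents

variable {K : Type*} [Field K]

theorem sum_of_le_of_card_eq_one {a b c d : K} {s : Multiset K} (h : s ≤ {a, b, c, d})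
    (hs : s.card = 1) : s.sum = a ∨ s.sum = b ∨ s.sum = c ∨ s.sum = d := by
  have h1 : s ∈ Multiset.powersetCard 1 (a ::ₘ b ::ₘ c ::ₘ d ::ₘ 0) :=
    Multiset.mem_powersetCard.mpr ⟨h, hs⟩
  simp [Multiset.powersetCard_one] at h1
  rcases h1 with rfl | rfl | rfl | rfl <;> simp

theorem sum_of_le_of_card_eq_two {a b c d : K} {s : Multiset K} (h : s ≤ {a, b, c, d})
    (hs : s.card = 2) : s.sum = a + b ∨ s.sum = a + c ∨ s.sum = a + d ∨ s.sum = b + c ∨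
      s.sum = b + d ∨ s.sum = c + d := by
  have h1 : s ∈ Multiset.powersetCard 2 (a ::ₘ b ::ₘ c ::ₘ d ::ₘ 0) :=
    Multiset.mem_powersetCard.mpr ⟨h, hs⟩
  simp only [Multiset.powersetCard_cons, Multiset.powersetCard_zero_left,
    Multiset.powersetCard_zero_right] at h1
  simp at h1
  rcases h1 with rfl | rfl | rfl | rfl | rfl | rfl <;> simp

theorem sum_of_le_of_card_eq_three {a b c d : K} {s : Multiset K} (h : s ≤ {a, b, c, d})
    (hs : s.card = 3) : s.sum = a + b + c ∨ s.sum = a + b + d ∨ s.sum = a + c + d ∨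
      s.sum = b + c + d := by
  have h1 : s ∈ Multiset.powersetCard 3 (a ::ₘ b ::ₘ c ::ₘ d ::ₘ 0) :=
    Multiset.mem_powersetCard.mpr ⟨h, hs⟩
  simp only [Multiset.powersetCard_cons, Multiset.powersetCard_zero_left,
    Multiset.powersetCard_zero_right] at h1
  simp at h1
  rcases h1 with rfl | rfl | rfl | rfl <;> simp [add_assoc]

theorem card_cases {α : Type*} {s : Multiset α} {k : ℕ} (hk : k < 3) (hs : s.card = k + 1) :
    (k = 0 ∧ s.card = 1) ∨ (k = 1 ∧ s.card = 2) ∨ (k = 2 ∧ s.card = 3) := by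
  lia

variable [CharZero K] {k : ℕ} {s : Multiset K}

/-- The exponents of a right factor of order `k + 1` at an ordinary point are distinct natural
numbers, so their sum is at least `k (k + 1) / 2`. -/
theorem exists_sum_eq_ordinary (hk : k < 3) (hs : s.card = k + 1)
    (h : s ≤ ({0, 1, 2, 3} : Multiset K)) :
    ∃ N : ℕ, (k * (k + 1) / 2 : K) - s.sum = -N := by
  rcases card_cases hk hs with ⟨rfl, h1⟩ | ⟨rfl, h1⟩ | ⟨rfl, h1⟩
  · rcases sum_of_le_of_card_eq_one h h1 with h | h | h | h <;> rw [h]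
    exacts [⟨0, by norm_num⟩, ⟨1, by norm_num⟩, ⟨2, by norm_num⟩, ⟨3, by norm_num⟩]
  · rcases sum_of_le_of_card_eq_two h h1 with h | h | h | h | h | h <;> rw [h]
    exacts [⟨0, by norm_num⟩, ⟨1, by norm_num⟩, ⟨2, by norm_num⟩, ⟨2, by norm_num⟩,
      ⟨3, by norm_num⟩, ⟨4, by norm_num⟩]
  · rcases sum_of_le_of_card_eq_three h h1 with h | h | h | h <;> rw [h]
    exacts [⟨0, by norm_num⟩, ⟨1, by norm_num⟩, ⟨2, by norm_num⟩, ⟨3, by norm_num⟩]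

/-- Sums of `k + 1` exponents at `t = 1`, modulo the integers, and exactly in the only case that
congruences modulo the integers do not exclude. -/
theorem exists_sum_eq_one {A₀ : K} (hk : k < 3) (hs : s.card = k + 1)
    (h : s ≤ ({0, 2 * A₀, A₀ - 1 / 2, A₀ + 1 / 2} : Multiset K)) :
    ∃ ε m : ℤ, |ε| ≤ 1 ∧ s.sum = (k + 1 + ε) * (A₀ + 1 / 2) + m ∧
      (k = 1 → ε = 0 → s.sum = 2 * A₀) := by
  rcases card_cases hk hs with ⟨rfl, h1⟩ | ⟨rfl, h1⟩ | ⟨rfl, h1⟩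
  · rcases sum_of_le_of_card_eq_one h h1 with h | h | h | h <;> rw [h]
    · exact ⟨-1, 0, by simp, by push_cast; ring, by simp⟩
    · exact ⟨1, -1, by simp, by push_cast; ring, by simp⟩
    · exact ⟨0, -1, by simp, by push_cast; ring, by simp⟩
    · exact ⟨0, 0, by simp, by push_cast; ring, by simp⟩
  · rcases sum_of_le_of_card_eq_two h h1 with h | h | h | h | h | h <;> rw [h]
    · exact ⟨0, -1, by simp, by push_cast; ring, by simp⟩
    · exact ⟨-1, -1, by simp, by push_cast; ring, by simp⟩
    · exact ⟨-1, 0, by simp, by push_cast; ring, by simp⟩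
    · exact ⟨1, -2, by simp, by push_cast; ring, by simp⟩
    · exact ⟨1, -1, by simp, by push_cast; ring, by simp⟩
    · exact ⟨0, -1, by simp, by push_cast; ring, fun _ _ => by ring⟩
  · rcases sum_of_le_of_card_eq_three h h1 with h | h | h | h <;> rw [h]
    · exact ⟨0, -2, by simp, by push_cast; ring, by simp⟩
    · exact ⟨0, -1, by simp, by push_cast; ring, by simp⟩
    · exact ⟨-1, -1, by simp, by push_cast; ring, by simp⟩
    · exact ⟨1, -2, by simp, by push_cast; ring, by simp⟩

/-- Sums of `k + 1` exponents at `t = -1`, as in `exists_sum_eq_one`. -/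
theorem exists_sum_eq_neg_one {A₁ : K} (hk : k < 3) (hs : s.card = k + 1)
    (h : s ≤ ({0, 1, 1 / 2 + A₁, 1 / 2 - A₁} : Multiset K)) :
    ∃ ε m : ℤ, |ε| ≤ 1 ∧ s.sum = ε * (A₁ + 1 / 2) + m ∧ (k = 1 → ε = 0 → s.sum = 1) := by
  rcases card_cases hk hs with ⟨rfl, h1⟩ | ⟨rfl, h1⟩ | ⟨rfl, h1⟩
  · rcases sum_of_le_of_card_eq_one h h1 with h | h | h | h <;> rw [h]
    · exact ⟨0, 0, by simp, by push_cast; ring, by simp⟩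
    · exact ⟨0, 1, by simp, by push_cast; ring, by simp⟩
    · exact ⟨1, 0, by simp, by push_cast; ring, by simp⟩
    · exact ⟨-1, 1, by simp, by push_cast; ring, by simp⟩
  · rcases sum_of_le_of_card_eq_two h h1 with h | h | h | h | h | h <;> rw [h]
    · exact ⟨0, 1, by simp, by push_cast; ring, by simp⟩
    · exact ⟨1, 0, by simp, by push_cast; ring, by simp⟩
    · exact ⟨-1, 1, by simp, by push_cast; ring, by simp⟩
    · exact ⟨1, 1, by simp, by push_cast; ring, by simp⟩
    · exact ⟨-1, 2, by simp, by push_cast; ring, by simp⟩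
    · exact ⟨0, 1, by simp, by push_cast; ring, fun _ _ => by ring⟩
  · rcases sum_of_le_of_card_eq_three h h1 with h | h | h | h <;> rw [h]
    · exact ⟨1, 1, by simp, by push_cast; ring, by simp⟩
    · exact ⟨-1, 2, by simp, by push_cast; ring, by simp⟩
    · exact ⟨0, 1, by simp, by push_cast; ring, by simp⟩
    · exact ⟨0, 2, by simp, by push_cast; ring, by simp⟩

/-- Sums of `k + 1` exponents at infinity, as in `exists_sum_eq_one`. For `k ≠ 1` the coefficients
of `A₂ + 1/2` and `A₃ + 1/2` cannot both vanish. -/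
theorem exists_sum_eq_infinity {A₀ A₂ A₃ : K} (hk : k < 3) (hs : s.card = k + 1)
    (h : s ≤ ({1 - A₀ + A₂, 1 - A₀ - A₂, 1 - A₀ + A₃, 1 - A₀ - A₃} : Multiset K)) :
    ∃ ε δ m : ℤ, |ε| ≤ 1 ∧ |δ| ≤ 1 ∧
      s.sum = -(k + 1) * (A₀ + 1 / 2) + ε * (A₂ + 1 / 2) + δ * (A₃ + 1 / 2) + m ∧
      (ε = 0 → δ = 0 → k = 1 ∧ s.sum = 2 - 2 * A₀) := by
  rcases card_cases hk hs with ⟨rfl, h1⟩ | ⟨rfl, h1⟩ | ⟨rfl, h1⟩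
  · rcases sum_of_le_of_card_eq_one h h1 with h | h | h | h <;> rw [h]
    · exact ⟨1, 0, 1, by simp, by simp, by push_cast; ring, by simp⟩
    · exact ⟨-1, 0, 2, by simp, by simp, by push_cast; ring, by simp⟩
    · exact ⟨0, 1, 1, by simp, by simp, by push_cast; ring, by simp⟩
    · exact ⟨0, -1, 2, by simp, by simp, by push_cast; ring, by simp⟩
  · rcases sum_of_le_of_card_eq_two h h1 with h | h | h | h | h | h <;> rw [h]
    · exact ⟨0, 0, 3, by simp, by simp, by push_cast; ring, fun _ _ => ⟨rfl, by ring⟩⟩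
    · exact ⟨1, 1, 2, by simp, by simp, by push_cast; ring, by simp⟩
    · exact ⟨1, -1, 3, by simp, by simp, by push_cast; ring, by simp⟩
    · exact ⟨-1, 1, 3, by simp, by simp, by push_cast; ring, by simp⟩
    · exact ⟨-1, -1, 4, by simp, by simp, by push_cast; ring, by simp⟩
    · exact ⟨0, 0, 3, by simp, by simp, by push_cast; ring, fun _ _ => ⟨rfl, by ring⟩⟩
  · rcases sum_of_le_of_card_eq_three h h1 with h | h | h | h <;> rw [h]
    · exact ⟨0, 1, 4, by simp, by simp, by push_cast; ring, by simp⟩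
    · exact ⟨0, -1, 5, by simp, by simp, by push_cast; ring, by simp⟩
    · exact ⟨1, 0, 4, by simp, by simp, by push_cast; ring, by simp⟩
    · exact ⟨-1, 0, 5, by simp, by simp, by push_cast; ring, by simp⟩

end Exponents

/-! ### Irreducibility -/

section Irreducible

variable {K : Type*} [Field K] [CharZero K] {a A : Fin 4 → K}

/-- Under the genericity assumption, the exponents at `1`, `-1` and `∞` admit no choice of
`k + 1` exponents at each of these points that satisfies the Fuchs relation. The number `N` is the
contribution of the apparent singularities. -/
theorem fuchs_relation_ne
    (hA : ∀ ε : Fin 4 → ℤ, (∀ i, |ε i| ≤ 1) → ε ≠ 0 →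
      ∀ m : ℤ, ∑ i, (ε i : K) * (A i + 1 / 2) ≠ (m : K))
    {k : ℕ} (hk : k < 3) {s₁ s₂ s₃ : Multiset K}
    (h₁ : s₁ ≤ ({0, 2 * A 0, A 0 - 1 / 2, A 0 + 1 / 2} : Multiset K)) (c₁ : s₁.card = k + 1)
    (h₂ : s₂ ≤ ({0, 1, 1 / 2 + A 1, 1 / 2 - A 1} : Multiset K)) (c₂ : s₂.card = k + 1)
    (h₃ : s₃ ≤ ({1 - A 0 + A 2, 1 - A 0 - A 2, 1 - A 0 + A 3, 1 - A 0 - A 3} : Multiset K))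
    (c₃ : s₃.card = k + 1) (N : ℕ) :
    s₁.sum + s₂.sum + s₃.sum ≠ (k * (k + 1) / 2 : K) - N := by
  intro h
  obtain ⟨ε₀, m₁, b₀, e₁, i₁⟩ := exists_sum_eq_one hk c₁ h₁
  obtain ⟨ε₁, m₂, b₁, e₂, i₂⟩ := exists_sum_eq_neg_one hk c₂ h₂
  obtain ⟨ε₂, ε₃, m₃, b₂, b₃, e₃, i₃⟩ := exists_sum_eq_infinity hk c₃ h₃
  obtain ⟨M, hM⟩ : ∃ M : ℤ, (k * (k + 1) / 2 : K) = M := by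
    interval_cases k
    exacts [⟨0, by norm_num⟩, ⟨1, by norm_num⟩, ⟨3, by norm_num⟩]
  by_cases h0 : (![ε₀, ε₁, ε₂, ε₃] : Fin 4 → ℤ) = 0
  · have g₀ : ε₀ = 0 := congrFun h0 0
    have g₁ : ε₁ = 0 := congrFun h0 1
    have g₂ : ε₂ = 0 := congrFun h0 2
    have g₃ : ε₃ = 0 := congrFun h0 3
    -- only `k = 1` remains, where the left side is `3` and the right side is `1 - N`
    obtain ⟨rfl, g⟩ := i₃ g₂ g₃
    rw [i₁ rfl g₀, i₂ rfl g₁, g] at h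
    have h4 : ((N + 2 : ℕ) : K) = 0 := by
      push_cast at h ⊢
      linear_combination h
    exact absurd (Nat.cast_eq_zero.mp h4) (by lia)
  · refine hA _ ?_ h0 (M - N - m₁ - m₂ - m₃) ?_
    · intro i
      fin_cases i <;> assumption
    · rw [e₁, e₂, e₃, hM] at h
      simp only [Fin.sum_univ_four, Matrix.cons_val]
      push_cast
      linear_combination h

theorem isIrreducible_Z [IsAlgClosed K] (ha₀ : a 0 = 2 * A 0 - 3)
    (ha : ∀ i : Fin 4, i ≠ 0 → a i = A i ^ 2 - (A 0 - 1) ^ 2)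
    (hA : ∀ ε : Fin 4 → ℤ, (∀ i, |ε i| ≤ 1) → ε ≠ 0 →
      ∀ m : ℤ, ∑ i, (ε i : K) * (A i + 1 / 2) ≠ (m : K)) :
    IsIrreducible (Z a) := by
  classical
  refine ⟨4, by norm_num, hasOrder_Z a, fun L₁ L₂ n₁ n₂ h₁ h₂ hn₁ hn₂ hZ => ?_⟩
  have hn : 4 = n₁ + n₂ := (hZ ▸ hasOrder_Z a).eq_add_of_mul h₁ h₂
  obtain ⟨k, rfl⟩ : ∃ k, n₂ = k + 1 := ⟨n₂ - 1, by lia⟩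
  obtain ⟨f, hf, rfl⟩ := h₂
  have hk : k < 3 := by lia
  -- the exponents of `Z a` at the finite points
  set R : K → Multiset K := fun c => if c = 1 then {0, 2 * A 0, A 0 - 1 / 2, A 0 + 1 / 2} else
    if c = -1 then {0, 1, 1 / 2 + A 1, 1 / 2 - A 1} else {0, 1, 2, 3} with hR
  have hne : (-1 : K) ≠ 1 := by norm_num
  have hfin : ∀ c : K, ∃ s ≤ R c, s.card = k + 1 ∧
      HasValueAt c ((RatFunc.X - RatFunc.C c) * (f k / f (k + 1)))
        (k * (k + 1) / 2 - s.sum) := by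
    intro c
    have hR4 : (R c).card = 4 := by simp only [hR]; split_ifs <;> rfl
    have h : ∃ (e : ℤ) (κ : K), κ ≠ 0 ∧ (finitePlace c).IsIndicial (Z a) e
        (C κ * ((R c).map fun r => X - C r).prod) := by
      by_cases hc : c = 1
      · subst hc
        simpa only [hR, if_true] using isIndicial_Z_one ha₀
      · by_cases hc' : c = -1
        · subst hc'
          simpa only [hR, if_neg hne, if_true] using isIndicial_Z_neg_one ha₀ ha
        · simpa only [hR, if_neg hc, if_neg hc'] using isIndicial_Z_of_ne a hc hc'
    obtain ⟨e, κ, hκ, h⟩ := h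
    rw [hZ] at h
    obtain ⟨s, hs, hc, hv⟩ := h.exists_exponents hκ h₁ hf (by lia)
    refine ⟨s, hs, hc, ?_⟩
    change HasValueAt c ((RatFunc.X - RatFunc.C c) ^ (((1 : ℤˣ)) : ℤ) * (f k / f (k + 1)))
      (k * (k + 1) / 2 - ((((1 : ℤˣ)) : ℤ) : K) * s.sum) at hv
    simpa using hv
  choose s hs hcard hval using hfin
  obtain ⟨e, κ, hκ, hinf⟩ := isIndicial_Z_infinity ha₀ ha
  rw [hZ] at hinf
  obtain ⟨t, ht, htcard, htval⟩ := hinf.exists_exponents hκ h₁ hf (by rw [← hn]; rfl)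
  have htval' : (infinitePlace K).HasValue (RatFunc.X * (f k / f (k + 1)))
      (k * (k + 1) / 2 + t.sum) := by
    change (infinitePlace K).HasValue (RatFunc.X⁻¹ ^ (((-1 : ℤˣ)) : ℤ) * (f k / f (k + 1)))
      (k * (k + 1) / 2 - ((((-1 : ℤˣ)) : ℤ) : K) * t.sum) at htval
    simpa using htval
  obtain ⟨S, hS, hsum⟩ := exists_sum_residue hval htval' {1, -1}
  -- away from `1` and `-1` the residues are nonpositive integers
  have hord : ∀ c ∈ (S.erase 1).erase (-1), ∃ N : ℕ, (k * (k + 1) / 2 : K) - (s c).sum = -N := by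
    intro c hc
    simp only [Finset.mem_erase] at hc
    refine exists_sum_eq_ordinary hk (hcard c) ?_
    have := hs c
    simpa only [hR, if_neg hc.1, if_neg hc.2.1] using this
  choose! N hN using hord
  rw [← Finset.add_sum_erase S _ (hS (by simp : (1 : K) ∈ ({1, -1} : Finset K))),
    ← Finset.add_sum_erase (S.erase 1) _
      (Finset.mem_erase.mpr ⟨hne, hS (by simp : (-1 : K) ∈ ({1, -1} : Finset K))⟩),
    Finset.sum_congr rfl hN] at hsum
  have h1 : s 1 ≤ {0, 2 * A 0, A 0 - 1 / 2, A 0 + 1 / 2} := by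
    simpa only [hR, if_true] using hs 1
  have h2 : s (-1) ≤ {0, 1, 1 / 2 + A 1, 1 / 2 - A 1} := by
    simpa only [hR, if_neg hne, if_true] using hs (-1)
  refine fuchs_relation_ne hA hk h1 (hcard 1) h2 (hcard (-1)) ht htcard
    (∑ c ∈ (S.erase 1).erase (-1), N c) ?_
  rw [Finset.sum_neg_distrib] at hsum
  push_cast
  linear_combination hsum

end Irreducible

/-! ### Singular points -/

section Singular

variable {K : Type*} [Field K]

theorem prod_X_sub_C_ne_zero {κ : K} (hκ : κ ≠ 0) (R : Multiset K) :
    C κ * (R.map fun r => X - C r).prod ≠ 0 :=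
  mul_ne_zero (C_ne_zero.mpr hκ)
    (monic_multiset_prod_of_monic _ _ fun r _ => monic_X_sub_C r).ne_zero

theorem natDegree_C_mul_prod_X_sub_C {κ : K} (hκ : κ ≠ 0) (R : Multiset K) :
    (C κ * (R.map fun r => X - C r).prod).natDegree = R.card := by
  rw [natDegree_C_mul hκ, natDegree_multiset_prod_X_sub_C_eq_card]

theorem eval_C_mul_prod_X_sub_C {κ r : K} {R : Multiset K} (hr : r ∈ R) :
    (C κ * (R.map fun r => X - C r).prod).eval r = 0 := by
  obtain ⟨R', rfl⟩ := Multiset.exists_cons_of_mem hr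
  simp

variable [CharZero K] {a A : Fin 4 → K}

theorem isFuchsian_Z (ha₀ : a 0 = 2 * A 0 - 3)
    (ha : ∀ i : Fin 4, i ≠ 0 → a i = A i ^ 2 - (A 0 - 1) ^ 2) : IsFuchsian (Z a) := by
  refine ⟨fun c => ?_, ?_⟩
  · by_cases h1 : c = 1
    · obtain ⟨e, κ, hκ, h⟩ := isIndicial_Z_one ha₀
      subst h1
      exact (hasOrder_Z a).isFuchsianFin h (prod_X_sub_C_ne_zero hκ _)
        (natDegree_C_mul_prod_X_sub_C hκ _)
    · by_cases h2 : c = -1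
      · obtain ⟨e, κ, hκ, h⟩ := isIndicial_Z_neg_one ha₀ ha
        subst h2
        exact (hasOrder_Z a).isFuchsianFin h (prod_X_sub_C_ne_zero hκ _)
          (natDegree_C_mul_prod_X_sub_C hκ _)
      · obtain ⟨e, κ, hκ, h⟩ := isIndicial_Z_of_ne a h1 h2
        exact (hasOrder_Z a).isFuchsianFin h (prod_X_sub_C_ne_zero hκ _)
          (natDegree_C_mul_prod_X_sub_C hκ _)
  · obtain ⟨e, κ, hκ, h⟩ := isIndicial_Z_infinity ha₀ ha
    exact (hasOrder_Z a).atInfinity.isFuchsianFin h.atInfinity (prod_X_sub_C_ne_zero hκ _)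
      (natDegree_C_mul_prod_X_sub_C hκ _)

theorem isOrdinaryFin_Z (a : Fin 4 → K) {c : K} (h1 : c ≠ 1) (h2 : c ≠ -1) :
    IsOrdinaryFin (Z a) c := by
  have hne : algebraMap K[X] (RatFunc K) (zPoly a 4) ≠ 0 :=
    RatFunc.algebraMap_ne_zero (zPoly_four_ne_zero a)
  refine ⟨4, _, _, hne, (Z_eq_sum a).trans
    (sum_eq_mulOp_mul (f := fun i => algebraMap K[X] (RatFunc K) (zPoly a i)) hne), ?_⟩
  intro i _
  rw [div_eq_mul_inv]
  have h3 : c - 1 ≠ 0 := sub_ne_zero.mpr h1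
  have h4 : c + 1 ≠ 0 := fun h => h2 (eq_neg_of_add_eq_zero_left h)
  exact isRegularAt_iff.mpr ⟨_, (hasValueAt_algebraMap c _).mul
    ((hasValueAt_algebraMap c _).inv (by simp [zPoly, zCoeff, h3, h4]))⟩

/-- Each of the points `1`, `-1`, `∞` has an exponent that is not an integer. -/
theorem singularPoints_Z (ha₀ : a 0 = 2 * A 0 - 3)
    (ha : ∀ i : Fin 4, i ≠ 0 → a i = A i ^ 2 - (A 0 - 1) ^ 2)
    (hA : ∀ ε : Fin 4 → ℤ, (∀ i, |ε i| ≤ 1) → ε ≠ 0 →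
      ∀ m : ℤ, ∑ i, (ε i : K) * (A i + 1 / 2) ≠ (m : K)) :
    singularPoints (Z a) =
      {((1 : K) : OnePoint K), ((-1 : K) : OnePoint K), (OnePoint.infty : OnePoint K)} := by
  ext x
  simp only [Set.mem_insert_iff, Set.mem_singleton_iff]
  induction x using OnePoint.rec with
  | infty =>
    simp only [or_true, iff_true]
    obtain ⟨e, κ, hκ, h⟩ := isIndicial_Z_infinity ha₀ ha
    refine not_isOrdinaryFin h.atInfinity (prod_X_sub_C_ne_zero hκ _) (r := 1 - A 0 + A 2)
      (eval_C_mul_prod_X_sub_C (by simp)) fun m hm => ?_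
    refine hA ![-1, 0, 1, 0] (by intro i; fin_cases i <;> simp)
      (fun h => by simpa using congrFun h 0) (m - 1) ?_
    simp only [Fin.sum_univ_four, Matrix.cons_val]
    push_cast
    linear_combination hm
  | coe c =>
    simp only [OnePoint.coe_eq_coe, OnePoint.coe_ne_infty, or_false]
    change ¬ IsOrdinaryFin (Z a) c ↔ _
    constructor
    · intro h
      by_contra! h'
      exact h (isOrdinaryFin_Z a h'.1 h'.2)
    · rintro (rfl | rfl)
      · obtain ⟨e, κ, hκ, h⟩ := isIndicial_Z_one ha₀
        refine not_isOrdinaryFin h (prod_X_sub_C_ne_zero hκ _) (r := A 0 + 1 / 2)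
          (eval_C_mul_prod_X_sub_C (by simp)) fun m hm => ?_
        refine hA ![1, 0, 0, 0] (by intro i; fin_cases i <;> simp)
          (fun h => by simpa using congrFun h 0) m ?_
        simp only [Fin.sum_univ_four, Matrix.cons_val]
        push_cast
        linear_combination hm
      · obtain ⟨e, κ, hκ, h⟩ := isIndicial_Z_neg_one ha₀ ha
        refine not_isOrdinaryFin h (prod_X_sub_C_ne_zero hκ _) (r := 1 / 2 + A 1)
          (eval_C_mul_prod_X_sub_C (by simp)) fun m hm => ?_
        refine hA ![0, 1, 0, 0] (by intro i; fin_cases i <;> simp)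
          (fun h => by simpa using congrFun h 1) m ?_
        simp only [Fin.sum_univ_four, Matrix.cons_val]
        push_cast
        linear_combination hm

end Singular

end FuchsODE

theorem mainTheorem4 {K : Type*} [Field K] [IsAlgClosed K] [CharZero K] (a A : Fin 4 → K)
    (ha₀ : a 0 = 2 * A 0 - 3)
    (ha : ∀ i : Fin 4, i ≠ 0 → a i = A i ^ 2 - (A 0 - 1) ^ 2)
    (hA : ∀ ε : Fin 4 → ℤ, (∀ i, |ε i| ≤ 1) → ε ≠ 0 →
      ∀ m : ℤ, ∑ i, (ε i : K) * (A i + 1 / 2) ≠ (m : K)) :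
    FuchsODE.HasOrder (FuchsODE.Z a) 4 ∧
    FuchsODE.IsFuchsian (FuchsODE.Z a) ∧
    FuchsODE.singularPoints (FuchsODE.Z a) =
      {((1 : K) : OnePoint K), ((-1 : K) : OnePoint K), (OnePoint.infty : OnePoint K)} ∧
    FuchsODE.IsIrreducible (FuchsODE.Z a) :=
  ⟨FuchsODE.hasOrder_Z a, FuchsODE.isFuchsian_Z ha₀ ha, FuchsODE.singularPoints_Z ha₀ ha hA,
    FuchsODE.isIrreducible_Z ha₀ ha hA⟩
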